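/- Let $J=\mathrm{diag}(1,-1,-1,1)$, $[x,y]_J=y^*Jx$ for $x,y\in\mathbb C^4$, and for $A\in M_4(\mathbb C)$ let $W^J_\pm(A)=\{[Ax,x]_J: [x,x]_J=\pm1\}$, $W^J(A)=-W^J_-(A)\cup W^J_+(A)$. Put $A^\#=JA^*J$, $\Re^J(A)=\frac12(A+A^\#)$, $\Im^J(A)=\frac1{2i}(A-A^\#)$, and let $C^J(A)\subset\mathbb R^2=\mathbb C$ be the set of real affine points of the algebraic curve with the equation $\det(u\,\Re^J(A)+v\,\Im^J(A)+w\,I)=0$ in homogeneous line coordinates (the triple $(u,v,w)$ standing for the line $ux+vy+w=0$), that is, of the union of the dual curves of the irreducible factors over $\mathbb C$ of this polynomial. The pseudo-convex hull of a set $S\subset\mathbb C$ (with respect to $J$ and $A$) is the union, over all pairs of points $z_1=[Ax,x]_J/[x,x]_J$ and $z_2=[Ay,y]_J/[y,y]_J$ of $S$ (with $[x,x]_J,[y,y]_J\neq0$), of the segments $\{tz_1+(1-t)z_2: 0\le t\le1\}$ when $[x,x]_J[y,y]_J>0$, and of the rays $\{tz_1+(1-t)z_2: t\le0 \text{ or }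 t\ge1\}$ when $[x,x]_J[y,y]_J<0$. A nondegenerate hyperbola has two distinct foci and transverse and non-transverse axes of positive length; a nondegenerate hyperbolic disc is the closed region bounded by such a hyperbola that contains its foci. **Theorem.** Let $a\in\mathbb R$, $b_1,b_2,b_3\in\mathbb C$ and $$A=\begin{pmatrix} a&b_1&0&0\\ b_3&-a&b_2&0\\ 0&b_2&-a&b_3\\ 0&0&b_1&a\end{pmatrix},$$ $$\Delta=a^2+b_1b_3,\qquad \Delta_\pm=\Delta\mp a\,b_2+\tfrac14 b_2^2,$$ $$M=2a^2-|b_1|^2-|b_3|^2,\qquad M_\pm=M+\tfrac12|b_2|^2\mp 2a\,\Re(b_2).$$ (a) $C^J(A)$ is the union of two nondegenerate and nonconcentric hyperbolas if and only if $$b_2\neq0,\qquad |M_+|<2|\Delta_+|\qquad\text{and}\qquad |M_-|<2|\Delta_-|.$$ In this case $C^J(A)=\mathcal H_+\cup\mathcal H_-$, and $W^J(A)$ is the pseudo-convex hull of $\mathcal H_+\cup\mathcal H_-$, where $\mathcal H_+$ (resp. $\mathcal H_-$) is the nondegenerate hyperbola with foci $\frac12b_2\pm\sqrt{\Delta_+}$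 (resp. $-\frac12b_2\pm\sqrt{\Delta_-}$) and non-transverse axis of length $(2|\Delta_+|-M_+)^{1/2}$ (resp. $(2|\Delta_-|-M_-)^{1/2}$). Under these conditions flat portions on the boundary may exist, and $W^J(A)$ may be the whole complex plane: for some such $a,b_1,b_2,b_3$ the boundary of $W^J(A)$ contains a nondegenerate line segment, and for some such $a,b_1,b_2,b_3$ one has $W^J(A)=\mathbb C$. (b) If $b_2=0$ and $|M|<2|\Delta|$, then $W^J(A)$ is a nondegenerate hyperbolic disc with foci $\pm\sqrt\Delta$ and non-transverse axis of length $(2|\Delta|-M)^{1/2}$. -/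

import Mathlib

open MvPolynomial

noncomputable section

namespace Krein

variable {n : Type} [Fintype n] [DecidableEq n]

/-- The indefinite inner product `[x, y]_J = y* J x`. -/
def inner (J : Matrix n n ℂ) (x y : n → ℂ) : ℂ :=
  star y ⬝ᵥ (J.mulVec x)

/-- The set of the `[A x, x]_J` with `[x, x]_J = 1`. -/
def rangePos (J A : Matrix n n ℂ) : Set ℂ :=
  {z | ∃ x : n → ℂ, inner J x x = 1 ∧ z = inner J (A.mulVec x) x}

/-- The set of the `[A x, x]_J` with `[x, x]_J = -1`. -/
def rangeNeg (J A : Matrix n n ℂ) : Set ℂ :=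
  {z | ∃ x : n → ℂ, inner J x x = -1 ∧ z = inner J (A.mulVec x) x}

/-- The Krein space numerical range `W^J(A)`, the union of `-W^J_-(A)` and `W^J_+(A)`. -/
def numRange (J A : Matrix n n ℂ) : Set ℂ :=
  {z | -z ∈ rangeNeg J A} ∪ rangePos J A

/-- The `J`-adjoint `J A* J`. -/
def adj (J A : Matrix n n ℂ) : Matrix n n ℂ := J * A.conjTranspose * J

/-- The `J`-Hermitian real part of `A`. -/
def rePart (J A : Matrix n n ℂ) : Matrix n n ℂ := (1 / 2 : ℂ) • (A + adj J A)

/-- The `J`-Hermitian imaginary part of `A`. -/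
def imPart (J A : Matrix n n ℂ) : Matrix n n ℂ :=
  (1 / (2 * Complex.I) : ℂ) • (A - adj J A)

/-- The homogeneous polynomial `det (u Re^J(A) + v Im^J(A) + w I)` in the line coordinates
`u = X 0`, `v = X 1`, `w = X 2`; these stand for the line `u x + v y + w = 0`. -/
def linePoly (J A : Matrix n n ℂ) : MvPolynomial (Fin 3) ℂ :=
  Matrix.det ((X 0 : MvPolynomial (Fin 3) ℂ) • (rePart J A).map C
    + (X 1 : MvPolynomial (Fin 3) ℂ) • (imPart J A).map C
    + (X 2 : MvPolynomial (Fin 3) ℂ) • (1 : Matrix n n (MvPolynomial (Fin 3) ℂ)))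

/-- The gradient of `g` at `ξ`. At a smooth point `ξ` of a curve of lines `g = 0` it gives the
homogeneous coordinates of the point where the line `ξ` touches its envelope. -/
def gradient (g : MvPolynomial (Fin 3) ℂ) (ξ : Fin 3 → ℂ) : Fin 3 → ℂ :=
  fun i => eval ξ (pderiv i g)

/-- The (affine cone over the) curve of points whose tangent lines are the zeros of an irreducible
`g`, that is, the dual curve of `g = 0`: the Zariski closure of the set of the points of contact.
For `g = x₀ u + y₀ v + w` it is the single point `(x₀ : y₀ : 1)`. -/
def dualCurve (g : MvPolynomial (Fin 3) ℂ) : Set (Fin 3 → ℂ) :=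
  {P | ∀ h : MvPolynomial (Fin 3) ℂ,
    (∀ ξ : Fin 3 → ℂ, eval ξ g = 0 → eval (gradient g ξ) h = 0) → eval P h = 0}

/-- `C^J(A)`: the real (affine) points of the boundary generating curve, the algebraic curve
with the equation `linePoly J A = 0` in line coordinates, i.e. the union of the
dual curves of the irreducible factors. The real point `(x, y)` is the complex number `x + i y`. -/
def boundaryCurve (J A : Matrix n n ℂ) : Set ℂ :=
  {z | ∃ g : MvPolynomial (Fin 3) ℂ, Irreducible g ∧ g ∣ linePoly J A ∧
    (![(z.re : ℂ), (z.im : ℂ), 1] : Fin 3 → ℂ) ∈ dualCurve g}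

/-- The point of the numerical range generated by a vector `x` with `[x, x]_J ≠ 0`. -/
def point (J A : Matrix n n ℂ) (x : n → ℂ) : ℂ :=
  inner J (A.mulVec x) x / inner J x x

/-- The pseudo-convex hull of a set `S` of points (with respect to `J` and `A`): for any two points
of `S` generated by vectors `x` and `y`, take the line segment joining them if
`[x, x]_J [y, y]_J > 0` and the two complementary rays of their line
if `[x, x]_J [y, y]_J < 0`. For a Hermitian `J` the numbers `[x, x]_J` are real. -/
def pseudoConvexHull (J A : Matrix n n ℂ) (S : Set ℂ) : Set ℂ :=
  {z | ∃ x y : n → ℂ, point J A x ∈ S ∧ point J A y ∈ S ∧ ∃ t : ℝ,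
    z = t * point J A x + (1 - t) * point J A y ∧
    ((0 < (inner J x x).re * (inner J y y).re ∧ 0 ≤ t ∧ t ≤ 1) ∨
     ((inner J x x).re * (inner J y y).re < 0 ∧ (t ≤ 0 ∨ 1 ≤ t)))}

/-- A nondegenerate hyperbola in the complex plane, given by its foci and the full length of its
non-transverse axis. -/
structure Hyperbola where
  focus₁ : ℂ
  focus₂ : ℂ
  nonTransverse : ℝ
  pos : 0 < nonTransverse
  lt_dist : nonTransverse < dist focus₁ focus₂

namespace Hyperbola

/-- The midpoint of the foci. -/
def center (H : Hyperbola) : ℂ := (H.focus₁ + H.focus₂) / 2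

/-- The full length of the transverse axis. -/
def transverse (H : Hyperbola) : ℝ :=
  √(dist H.focus₁ H.focus₂ ^ 2 - H.nonTransverse ^ 2)

/-- The points of the hyperbola (both branches). -/
def curve (H : Hyperbola) : Set ℂ :=
  {z | |dist z H.focus₁ - dist z H.focus₂| = H.transverse}

/-- The hyperbolic disc bounded by the hyperbola: the closed region formed by the two
convex components that contain the foci. -/
def disc (H : Hyperbola) : Set ℂ :=
  {z | H.transverse ≤ |dist z H.focus₁ - dist z H.focus₂|}

end Hyperbola

/-- `J = diag(1, -1, -1, 1)`. -/
def J4 : Matrix (Fin 4) (Fin 4) ℂ := Matrix.diagonal ![1, -1, -1, 1]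

/-- The centrosymmetric tridiagonal matrix with main diagonal `(a, -a, -a, a)`,
first upper diagonal `(b₁, b₂, b₃)` and first lower diagonal `(b₃, b₂, b₁)`. -/
def A4 (a : ℝ) (b₁ b₂ b₃ : ℂ) : Matrix (Fin 4) (Fin 4) ℂ :=
  !![(a : ℂ), b₁, 0, 0;
     b₃, -(a : ℂ), b₂, 0;
     0, b₂, -(a : ℂ), b₃;
     0, 0, b₁, (a : ℂ)]

def Delta (a : ℝ) (b₁ b₃ : ℂ) : ℂ := (a : ℂ) ^ 2 + b₁ * b₃

def DeltaPlus (a : ℝ) (b₁ b₂ b₃ : ℂ) : ℂ := Delta a b₁ b₃ - a * b₂ + b₂ ^ 2 / 4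

def DeltaMinus (a : ℝ) (b₁ b₂ b₃ : ℂ) : ℂ := Delta a b₁ b₃ + a * b₂ + b₂ ^ 2 / 4

def M (a : ℝ) (b₁ b₃ : ℂ) : ℝ := 2 * a ^ 2 - ‖b₁‖ ^ 2 - ‖b₃‖ ^ 2

def MPlus (a : ℝ) (b₁ b₂ b₃ : ℂ) : ℝ := M a b₁ b₃ + ‖b₂‖ ^ 2 / 2 - 2 * a * b₂.re

def MMinus (a : ℝ) (b₁ b₂ b₃ : ℂ) : ℝ := M a b₁ b₃ + ‖b₂‖ ^ 2 / 2 + 2 * a * b₂.re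

/-- The condition for two nondegenerate nonconcentric hyperbolas. -/
def Bihyperbolic (a : ℝ) (b₁ b₂ b₃ : ℂ) : Prop :=
  b₂ ≠ 0 ∧ |MPlus a b₁ b₂ b₃| < 2 * ‖DeltaPlus a b₁ b₂ b₃‖ ∧
    |MMinus a b₁ b₂ b₃| < 2 * ‖DeltaMinus a b₁ b₂ b₃‖

end Krein

end

/-! The matrix commutes with the reversal of the coordinates, so symmetric and antisymmetric vectors
split it into two 2×2 blocks with the rows `(a, b₁)` and `(b₃, ±b₂ - a)`, each with `J = diag(1,
-1)` (`inner_A4_embed`, `linePoly_eq`).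

For one block `B`, consider the pairs `([v, v]_J, [B v, v]_J)` in ℝ × ℂ. If `|M| < 2‖Δ‖` for the
block, they lie in the closed future cone of a Minkowski form on this three-dimensional space, and
every vector of the light cone is attained (`exists_blockCoords`). The light cone is the cone over
the hyperbola of the block. Hence `W^J(A)` is the set of quotients `k.2 / k.1`, where `k` runs over
sums of one such pair from each block.

To place such a quotient in the pseudo-convex hull, `k` is rewritten as a sum of two light vectors
with nonzero first components (`LorentzCoords.exists_light_add`); the signs of these components
decide between segment and rays. Generically both summands are moved into the open cones and a plane
section supplies the light vectors. The obstruction is a common tangent plane touching one cone at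
an asymptotic direction and the other at a finite point. It does not occur: the tangent functional
pulls back to semidefinite Hermitian forms of the two blocks that differ in a single entry
(`blockVec_tangent`). The reverse inclusion is a Toeplitz–Hausdorff argument
(`pseudoConvex_numRange`). For `b₂ = 0` the two cones coincide, and convexity of the cone yields the
hyperbolic disc.

For the curve, the determinant is a product of two quadratic forms. A regular one is irreducible and
its dual is a central conic (`mem_blockCurve_iff`); a singular one splits into linear forms, whose
duals are points. A block with `|M| ≥ 2‖Δ‖` therefore contributes only a bounded set. Since a
hyperbola whose distant points lie on a given central hyperbola has the same centre
(`Hyperbola.center_eq`), two nonconcentric hyperbolas require both blocks to be hyperbolic, with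
different centres. -/

namespace Krein

open ComplexConjugate

noncomputable section

/-! ### Central conics and their focal description -/

/-- The quadratic form whose level set at `conicDisc Δ M` is a central conic. -/
def conicForm (Δ : ℂ) (M : ℝ) (f : ℂ) : ℝ :=
  8 * (conj Δ * f ^ 2).re - 4 * M * Complex.normSq f

/-- The level of `conicForm Δ M` at which the conic has the foci `± √Δ`. -/
def conicDisc (Δ : ℂ) (M : ℝ) : ℝ := 4 * ‖Δ‖ ^ 2 - M ^ 2

/-- A difference of squares, as `‖f - δ‖ * ‖f + δ‖ = ‖f ^ 2 - δ ^ 2‖`. By `sq_dist_sub` the first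
factor is the focal equation of the hyperbola; `factor_pos` disposes of the second. -/
theorem conicForm_sub_conicDisc (f δ : ℂ) (M : ℝ) :
    conicForm (δ ^ 2) M f - conicDisc (δ ^ 2) M =
      (2 * Complex.normSq f - M - 2 * (‖f - δ‖ * ‖f + δ‖)) *
        (2 * Complex.normSq f - M + 2 * (‖f - δ‖ * ‖f + δ‖)) := by
  have h1 : ‖f - δ‖ ^ 2 = Complex.normSq (f - δ) := Complex.sq_norm _
  have h2 : ‖f + δ‖ ^ 2 = Complex.normSq (f + δ) := Complex.sq_norm _
  have h3 : ‖δ‖ ^ 2 = Complex.normSq δ := Complex.sq_norm _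
  have h4 : (2 * Complex.normSq f - M - 2 * (‖f - δ‖ * ‖f + δ‖)) *
      (2 * Complex.normSq f - M + 2 * (‖f - δ‖ * ‖f + δ‖)) =
      (2 * Complex.normSq f - M) ^ 2 - 4 * (‖f - δ‖ ^ 2 * ‖f + δ‖ ^ 2) := by ring
  rw [h4, h1, h2, conicForm, conicDisc, norm_pow, h3]
  simp only [Complex.normSq_apply, pow_two, Complex.mul_re, Complex.mul_im, Complex.conj_re,
    Complex.conj_im, Complex.sub_re, Complex.sub_im, Complex.add_re, Complex.add_im]
  ring

theorem sq_dist_sub (f δ : ℂ) (M : ℝ) :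
    (‖f - δ‖ - ‖f + δ‖) ^ 2 - (2 * ‖δ‖ ^ 2 + M) =
      2 * Complex.normSq f - M - 2 * (‖f - δ‖ * ‖f + δ‖) := by
  have h1 : ‖f - δ‖ ^ 2 = Complex.normSq (f - δ) := Complex.sq_norm _
  have h2 : ‖f + δ‖ ^ 2 = Complex.normSq (f + δ) := Complex.sq_norm _
  have h3 : ‖δ‖ ^ 2 = Complex.normSq δ := Complex.sq_norm _
  have h4 : (‖f - δ‖ - ‖f + δ‖) ^ 2 = ‖f - δ‖ ^ 2 + ‖f + δ‖ ^ 2 - 2 * (‖f - δ‖ * ‖f + δ‖) := by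
    ring
  rw [h4, h1, h2, h3]
  simp only [Complex.normSq_apply, Complex.sub_re, Complex.sub_im, Complex.add_re, Complex.add_im]
  ring

theorem conicForm_le (Δ : ℂ) (M : ℝ) (f : ℂ) :
    conicForm Δ M f ≤ 4 * (2 * ‖Δ‖ - M) * Complex.normSq f := by
  have h := Complex.re_le_norm (conj Δ * f ^ 2)
  rw [norm_mul, norm_pow, Complex.sq_norm, Complex.norm_conj] at h
  unfold conicForm
  nlinarith

/-- `conicDisc` is `(2‖δ‖² - M)(2‖δ‖² + M)`. Cancelling the positive first factor against
`conicForm_le` gives `2‖δ‖² + M ≤ 4|f|²`, whence `2|f|² > M`. -/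
theorem factor_pos {f δ : ℂ} {M : ℝ} (hM : M < 2 * ‖δ‖ ^ 2)
    (h : conicDisc (δ ^ 2) M ≤ conicForm (δ ^ 2) M f) :
    0 < 2 * Complex.normSq f - M + 2 * (‖f - δ‖ * ‖f + δ‖) := by
  have h1 := conicForm_le (δ ^ 2) M f
  rw [norm_pow] at h1
  rw [conicDisc, norm_pow] at h
  have h2 : 2 * ‖δ‖ ^ 2 + M ≤ 4 * Complex.normSq f := by
    by_contra! h3
    nlinarith
  have : 0 ≤ ‖f - δ‖ * ‖f + δ‖ := by positivity
  nlinarith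

theorem sqrt_le_abs_dist_iff {f δ : ℂ} {M : ℝ} (hM : M < 2 * ‖δ‖ ^ 2) :
    √(2 * ‖δ‖ ^ 2 + M) ≤ |‖f - δ‖ - ‖f + δ‖| ↔ conicDisc (δ ^ 2) M ≤ conicForm (δ ^ 2) M f := by
  rw [Real.sqrt_le_left (abs_nonneg _), sq_abs, ← sub_nonneg, sq_dist_sub,
    ← sub_nonneg (b := conicDisc _ _), conicForm_sub_conicDisc]
  constructor
  · intro h
    have : 0 ≤ ‖f - δ‖ * ‖f + δ‖ := by positivity
    exact mul_nonneg h (by linarith)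
  · intro h
    have hp := factor_pos (f := f) hM (by rw [← sub_nonneg, conicForm_sub_conicDisc]; exact h)
    exact nonneg_of_mul_nonneg_left h hp

theorem abs_dist_eq_sqrt_iff {f δ : ℂ} {M : ℝ} (hM : M < 2 * ‖δ‖ ^ 2)
    (hM' : 0 ≤ 2 * ‖δ‖ ^ 2 + M) :
    |‖f - δ‖ - ‖f + δ‖| = √(2 * ‖δ‖ ^ 2 + M) ↔ conicForm (δ ^ 2) M f = conicDisc (δ ^ 2) M := by
  rw [eq_comm (b := √_), Real.sqrt_eq_iff_eq_sq hM' (abs_nonneg _), sq_abs, eq_comm, ← sub_eq_zero,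
    sq_dist_sub, ← sub_eq_zero (b := conicDisc _ _), conicForm_sub_conicDisc]
  constructor
  · intro h
    rw [h, zero_mul]
  · intro h
    have hp := factor_pos (f := f) hM (by rw [← sub_nonneg, conicForm_sub_conicDisc]; exact h.ge)
    exact (mul_eq_zero.1 h).resolve_right hp.ne'

namespace Hyperbola

/-- The difference of the squares of the transverse and the non-transverse axes, halved. -/
def param (H : Hyperbola) : ℝ := 2 * ‖(H.focus₁ - H.focus₂) / 2‖ ^ 2 - H.nonTransverse ^ 2

variable (H : Hyperbola)

theorem dist_eq : dist H.focus₁ H.focus₂ = 2 * ‖(H.focus₁ - H.focus₂) / 2‖ := by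
  rw [dist_eq_norm, norm_div]; simp; ring

theorem param_lt : H.param < 2 * ‖(H.focus₁ - H.focus₂) / 2‖ ^ 2 := by
  have := H.pos
  unfold param
  nlinarith

theorem neg_lt_param : 0 < 2 * ‖(H.focus₁ - H.focus₂) / 2‖ ^ 2 + H.param := by
  have h := H.lt_dist
  have := H.pos
  rw [dist_eq] at h
  unfold param
  nlinarith

theorem transverse_eq :
    H.transverse = √(2 * ‖(H.focus₁ - H.focus₂) / 2‖ ^ 2 + H.param) := by
  rw [transverse, dist_eq, param]; ring_nf

theorem dist_sub_eq (z : ℂ) : dist z H.focus₁ - dist z H.focus₂ =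
    ‖(z - H.center) - (H.focus₁ - H.focus₂) / 2‖ - ‖(z - H.center) + (H.focus₁ - H.focus₂) / 2‖ := by
  rw [dist_eq_norm, dist_eq_norm, center]; ring_nf

theorem mem_curve_iff (z : ℂ) : z ∈ H.curve ↔
    conicForm (((H.focus₁ - H.focus₂) / 2) ^ 2) H.param (z - H.center) =
      conicDisc (((H.focus₁ - H.focus₂) / 2) ^ 2) H.param := by
  rw [← abs_dist_eq_sqrt_iff H.param_lt H.neg_lt_param.le, ← dist_sub_eq, ← transverse_eq]; rfl

theorem mem_disc_iff (z : ℂ) : z ∈ H.disc ↔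
    conicDisc (((H.focus₁ - H.focus₂) / 2) ^ 2) H.param ≤
    conicForm (((H.focus₁ - H.focus₂) / 2) ^ 2) H.param (z - H.center) := by
  rw [← sqrt_le_abs_dist_iff H.param_lt, ← dist_sub_eq, ← transverse_eq]; rfl

/-- The hyperbola with centre `c` and foci `c ± δ` on which `conicForm (δ ^ 2) M` is
`conicDisc (δ ^ 2) M`. -/
@[simps] def ofCenter (c δ : ℂ) (M : ℝ) (hM : |M| < 2 * ‖δ ^ 2‖) : Hyperbola where
  focus₁ := c + δ
  focus₂ := c - δ
  nonTransverse := √(2 * ‖δ ^ 2‖ - M)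
  pos := Real.sqrt_pos.2 (by linarith [le_abs_self M])
  lt_dist := by
    have h : dist (c + δ) (c - δ) = 2 * ‖δ‖ := by
      rw [dist_eq_norm, show c + δ - (c - δ) = 2 * δ by ring, norm_mul]; simp
    rw [norm_pow] at hM ⊢
    have h0 : 0 < ‖δ‖ := by
      by_contra! h1
      have : ‖δ‖ = 0 := le_antisymm h1 (norm_nonneg _)
      rw [this] at hM
      linarith [abs_nonneg M]
    rw [h, Real.sqrt_lt' (by positivity)]
    nlinarith [neg_abs_le M]

theorem ofCenter_half (c δ : ℂ) (M : ℝ) (hM : |M| < 2 * ‖δ ^ 2‖) :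
    ((ofCenter c δ M hM).focus₁ - (ofCenter c δ M hM).focus₂) / 2 = δ := by
  simp

theorem ofCenter_param (c δ : ℂ) (M : ℝ) (hM : |M| < 2 * ‖δ ^ 2‖) :
    (ofCenter c δ M hM).param = M := by
  rw [param, ofCenter_half, ofCenter_nonTransverse, Real.sq_sqrt, norm_pow]
  · ring
  · linarith [le_abs_self M]

theorem ofCenter_center (c δ : ℂ) (M : ℝ) (hM : |M| < 2 * ‖δ ^ 2‖) :
    (ofCenter c δ M hM).center = c := by
  simp [center]

theorem mem_ofCenter_curve {c δ : ℂ} {M : ℝ} (hM : |M| < 2 * ‖δ ^ 2‖) (z : ℂ) :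
    z ∈ (ofCenter c δ M hM).curve ↔ conicForm (δ ^ 2) M (z - c) = conicDisc (δ ^ 2) M := by
  rw [mem_curve_iff, ofCenter_half, ofCenter_param, ofCenter_center]

theorem mem_ofCenter_disc {c δ : ℂ} {M : ℝ} (hM : |M| < 2 * ‖δ ^ 2‖) (z : ℂ) :
    z ∈ (ofCenter c δ M hM).disc ↔ conicDisc (δ ^ 2) M ≤ conicForm (δ ^ 2) M (z - c) := by
  rw [mem_disc_iff, ofCenter_half, ofCenter_param, ofCenter_center]

end Hyperbola

/-! ### The values of a single 2×2 block -/

/-- The `J`-norm `|p|² - |q|²` for `J = diag(1, -1)`. -/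
def blockNorm (p q : ℂ) : ℝ := Complex.normSq p - Complex.normSq q

/-- The form `[B v, v]_J` for `J = diag(1, -1)`, `v = (p, q)` and the traceless matrix `B` with the
rows `(α, β)` and `(γ, -α)`. -/
def blockForm (α β γ p q : ℂ) : ℂ :=
  α * ((Complex.normSq p + Complex.normSq q : ℝ) : ℂ) + β * (q * conj p) - γ * (p * conj q)

/-- `tr (B^# B)` for the traceless matrix `B` with the rows `(α, β)` and `(γ, -α)`. -/
def blockTrace (α β γ : ℂ) : ℝ := 2 * ‖α‖ ^ 2 - ‖β‖ ^ 2 - ‖γ‖ ^ 2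

/-- With `T = |p|² + |q|²` and `w = 2 q p̄`, the number `T² - |w|²` is the square of the `J`-norm
(`light_norm`). The excess of the conic over the cone is thus a perfect square, which is the source
of `conicDisc_mul_le`. -/
theorem conicForm_light (α β γ w : ℂ) (T : ℝ) :
    conicForm (α ^ 2 + β * γ) (blockTrace α β γ) (α * T + (β * w - γ * conj w) / 2) =
      conicDisc (α ^ 2 + β * γ) (blockTrace α β γ) * (T ^ 2 - Complex.normSq w) +
      (T * (Complex.normSq β - Complex.normSq γ) + 2 * (w * (conj α * β + α * conj γ)).re) ^ 2 := by
  unfold conicForm conicDisc blockTrace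
  simp only [Complex.sq_norm]
  apply Complex.ofReal_injective
  push_cast
  simp only [Complex.normSq_eq_conj_mul_self, Complex.re_eq_add_conj, map_mul, map_add, map_sub,
    map_pow, Complex.conj_conj, Complex.conj_ofReal, map_div₀, Complex.conj_ofNat]
  ring

theorem blockForm_eq (α β γ p q : ℂ) : blockForm α β γ p q =
    α * ((Complex.normSq p + Complex.normSq q : ℝ) : ℂ) +
      (β * (2 * q * conj p) - γ * conj (2 * q * conj p)) / 2 := by
  simp [blockForm, Complex.conj_ofNat]; ring

theorem light_norm (p q : ℂ) : (Complex.normSq p + Complex.normSq q) ^ 2 -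
    Complex.normSq (2 * q * conj p) = blockNorm p q ^ 2 := by
  simp [blockNorm]; norm_num; ring

theorem conicDisc_mul_le (α β γ p q : ℂ) :
    conicDisc (α ^ 2 + β * γ) (blockTrace α β γ) * blockNorm p q ^ 2 ≤
      conicForm (α ^ 2 + β * γ) (blockTrace α β γ) (blockForm α β γ p q) := by
  rw [blockForm_eq, conicForm_light, light_norm]
  nlinarith [sq_nonneg ((Complex.normSq p + Complex.normSq q) *
    (Complex.normSq β - Complex.normSq γ) + 2 * (2 * q * conj p * (conj α * β + α * conj γ)).re)]

/-- The Hermitian form `Re (δ̄ · blockForm)` has the diagonal entries `Re (δ̄ α)` and the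
off-diagonal entry `(δ̄ β - δ γ̄) / 2`. The identity computes its determinant as `‖Δ‖ (M + 2‖Δ‖) /
4`, so the form is definite in the hyperbolic case. -/
theorem orientation_sq {α β γ δ : ℂ} (hδ : δ ^ 2 = α ^ 2 + β * γ) :
    4 * (conj δ * α).re ^ 2 = ‖conj δ * β - δ * conj γ‖ ^ 2 +
      ‖α ^ 2 + β * γ‖ * (blockTrace α β γ + 2 * ‖α ^ 2 + β * γ‖) := by
  have h0 : ‖α ^ 2 + β * γ‖ = Complex.normSq δ := by rw [← hδ, norm_pow, Complex.sq_norm]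
  have hc : conj δ ^ 2 = conj α ^ 2 + conj β * conj γ := by
    rw [← map_pow, hδ]; simp
  rw [h0]
  simp only [blockTrace, Complex.sq_norm]
  apply Complex.ofReal_injective
  push_cast
  simp only [Complex.normSq_eq_conj_mul_self, Complex.re_eq_add_conj, map_mul, map_sub,
    Complex.conj_conj]
  linear_combination -(conj δ ^ 2) * hδ - δ ^ 2 * hc

/-- Definiteness keeps all values in one nappe of the double cone. -/
theorem blockForm_re_pos {α β γ δ : ℂ} (hδ : δ ^ 2 = α ^ 2 + β * γ)
    (hM : |blockTrace α β γ| < 2 * ‖α ^ 2 + β * γ‖) (hα : 0 ≤ (conj δ * α).re) {p q : ℂ}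
    (h : (p, q) ≠ 0) : 0 < (conj δ * blockForm α β γ p q).re := by
  have h1 := orientation_sq hδ
  have h2 : 0 < ‖α ^ 2 + β * γ‖ := by linarith [abs_nonneg (blockTrace α β γ)]
  have h3 : 0 < ‖α ^ 2 + β * γ‖ * (blockTrace α β γ + 2 * ‖α ^ 2 + β * γ‖) :=
    mul_pos h2 (by linarith [neg_abs_le (blockTrace α β γ)])
  have h4 : ‖conj δ * β - δ * conj γ‖ < 2 * (conj δ * α).re := by
    apply lt_of_pow_lt_pow_left₀ 2 (by linarith)
    linarith
  set w := q * conj p with hw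
  have h5 : (conj δ * blockForm α β γ p q).re =
      (Complex.normSq p + Complex.normSq q) * (conj δ * α).re +
        (w * (conj δ * β - δ * conj γ)).re := by
    have : p * conj q = conj w := by rw [hw]; simp; ring
    rw [blockForm, this, ← hw]
    simp only [Complex.mul_re, Complex.mul_im, Complex.add_re, Complex.add_im, Complex.sub_re,
      Complex.sub_im, Complex.conj_re, Complex.conj_im, Complex.ofReal_re, Complex.ofReal_im]
    ring
  have h6 : -(‖w‖ * ‖conj δ * β - δ * conj γ‖) ≤ (w * (conj δ * β - δ * conj γ)).re := by
    rw [← norm_mul]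
    exact (abs_le.1 (Complex.abs_re_le_norm _)).1
  have h7 : 2 * ‖w‖ ≤ Complex.normSq p + Complex.normSq q := by
    rw [hw, norm_mul, Complex.norm_conj, ← Complex.sq_norm, ← Complex.sq_norm]
    nlinarith [sq_nonneg (‖p‖ - ‖q‖)]
  have h8 : 0 < Complex.normSq p + Complex.normSq q := by
    by_contra! h9
    have hp : Complex.normSq p = 0 := by linarith [Complex.normSq_nonneg p, Complex.normSq_nonneg q]
    have hq : Complex.normSq q = 0 := by linarith [Complex.normSq_nonneg p, Complex.normSq_nonneg q]
    exact h (Prod.ext (Complex.normSq_eq_zero.1 hp) (Complex.normSq_eq_zero.1 hq))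
  rw [h5]
  have h9 := norm_nonneg w
  have h10 := norm_nonneg (conj δ * β - δ * conj γ)
  nlinarith

theorem exists_orientation {α β γ δ : ℂ} (hδ : δ ^ 2 = α ^ 2 + β * γ) :
    ∃ ε : ℂ, ε ^ 2 = α ^ 2 + β * γ ∧ 0 ≤ (conj ε * α).re := by
  rcases le_total 0 (conj δ * α).re with h | h
  · exact ⟨δ, hδ, h⟩
  · exact ⟨-δ, by simpa using hδ, by rw [map_neg, neg_mul, Complex.neg_re]; linarith⟩

/-- A future light vector of four-dimensional Minkowski space is a rank-one Hermitian matrix `v v*`.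
Here `|p|² = (T + n) / 2` is forced, and `p` may be taken real; `T + n = 0` means `p = 0`. -/
theorem exists_spinor {n T : ℝ} {w : ℂ} (h : T ^ 2 - Complex.normSq w = n ^ 2) (hT : 0 ≤ T) :
    ∃ p q : ℂ, blockNorm p q = n ∧ Complex.normSq p + Complex.normSq q = T ∧ 2 * q * conj p = w := by
  have hw := Complex.normSq_nonneg w
  have hn : |n| ≤ T := abs_le_of_sq_le_sq (by linarith) hT
  obtain ⟨hn1, hn2⟩ := abs_le.1 hn
  rcases eq_or_lt_of_le hn1 with h0 | h0
  · have hw0 : w = 0 := Complex.normSq_eq_zero.1 (by rw [← h0] at h; linarith)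
    refine ⟨0, (√T : ℝ), ?_, ?_, ?_⟩ <;> simp [blockNorm, Real.mul_self_sqrt hT, hw0, ← h0]
  · set s := √((T + n) / 2) with hs
    have hs2 : s * s = (T + n) / 2 := Real.mul_self_sqrt (by linarith)
    have hs0 : 0 < s := Real.sqrt_pos.2 (by linarith)
    have hq : Complex.normSq (w / (2 * s)) = (T - n) / 2 := by
      rw [Complex.normSq_div]
      have : Complex.normSq (2 * (s : ℂ)) = 4 * (s * s) := by simp; norm_num
      rw [this, hs2, div_eq_iff (by linarith)]
      linarith
    have hp : Complex.normSq (s : ℂ) = (T + n) / 2 := by rw [Complex.normSq_ofReal, hs2]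
    refine ⟨s, w / (2 * s), ?_, ?_, ?_⟩
    · rw [blockNorm, hp, hq]; ring
    · rw [hp, hq]; ring
    · have : (s : ℂ) ≠ 0 := by exact_mod_cast hs0.ne'
      rw [Complex.conj_ofReal]; field_simp

theorem conicDisc_pos {Δ : ℂ} {M : ℝ} (hM : |M| < 2 * ‖Δ‖) : 0 < conicDisc Δ M := by
  have := abs_nonneg M
  rw [conicDisc, ← sq_abs M]
  nlinarith

/-- Among the preimages of `f` under `(T, w) ↦ α T + (β w - γ w̄) / 2`, take the one orthogonal to
the kernel with respect to `T² - |w|²`; there the square in `conicForm_light` vanishes. It is the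
image of `s` under the adjoint map, and `s` solves a real linear system that is regular for a
nonzero `conicDisc`. -/
theorem exists_light (α β γ f : ℂ) (hD : conicDisc (α ^ 2 + β * γ) (blockTrace α β γ) ≠ 0) :
    ∃ (T : ℝ) (w : ℂ), f = α * T + (β * w - γ * conj w) / 2 ∧
      conicDisc (α ^ 2 + β * γ) (blockTrace α β γ) * (T ^ 2 - Complex.normSq w) =
        conicForm (α ^ 2 + β * γ) (blockTrace α β γ) f := by
  set Δ := α ^ 2 + β * γ with hΔ
  set M := blockTrace α β γ with hM
  set D := conicDisc Δ M with hDdef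
  set s : ℂ := 4 * (2 * Δ * conj f - M * f) / D with hs
  have hDc : (D : ℂ) ≠ 0 := by exact_mod_cast hD
  have hM' : (M : ℂ) = 2 * (α * conj α) - β * conj β - γ * conj γ := by
    rw [hM, blockTrace]
    push_cast
    simp only [← Complex.mul_conj']
  have hD' : (D : ℂ) = 4 * (Δ * conj Δ) - M ^ 2 := by
    rw [hDdef, conicDisc]
    push_cast
    simp only [← Complex.mul_conj']
  have hΔ' : conj Δ = conj α ^ 2 + conj β * conj γ := by rw [hΔ]; simp
  have hsD : D * s = 4 * (2 * Δ * conj f - M * f) := by rw [hs]; field_simp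
  have hsD' : D * conj s = 4 * (2 * conj Δ * f - M * conj f) := by
    have := congrArg conj hsD
    simpa [Complex.conj_ofNat] using this
  refine ⟨(conj s * α).re, (conj s * γ - s * conj β) / 2, ?_, ?_⟩
  · apply mul_left_cancel₀ hDc
    rw [Complex.re_eq_add_conj]
    simp only [map_mul, map_sub, map_div₀, Complex.conj_conj, Complex.conj_ofNat]
    have h1 : f * D = (M * (D * s) + 2 * Δ * (D * conj s)) / 4 := by
      rw [hsD, hsD', hD']; ring
    rw [mul_comm, h1, hM', hΔ]; ring
  · have h2 : (((conj s * α).re ^ 2 - Complex.normSq ((conj s * γ - s * conj β) / 2) : ℝ) : ℂ) =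
        (M * (s * conj s) + (Δ * conj s ^ 2 + conj Δ * s ^ 2)) / 4 := by
      push_cast
      rw [Complex.normSq_eq_conj_mul_self, Complex.re_eq_add_conj, hM', hΔ', hΔ]
      simp only [map_mul, map_sub, map_div₀, Complex.conj_conj, Complex.conj_ofNat]
      ring
    apply Complex.ofReal_injective
    apply mul_left_cancel₀ hDc
    rw [Complex.ofReal_mul, h2]
    have h3 : (D : ℂ) * (D * ((M * (s * conj s) + (Δ * conj s ^ 2 + conj Δ * s ^ 2)) / 4)) =
      (M * ((D * s) * (D * conj s)) + (Δ * (D * conj s) ^ 2 + conj Δ * (D * s) ^ 2)) / 4 := by ring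
    rw [h3, hsD, hsD', hD', conicForm]
    push_cast
    rw [Complex.normSq_eq_conj_mul_self, Complex.re_eq_add_conj]
    simp only [map_mul, map_pow, Complex.conj_conj]
    ring

theorem exists_blockForm_eq {α β γ δ : ℂ} (hδ : δ ^ 2 = α ^ 2 + β * γ)
    (hM : |blockTrace α β γ| < 2 * ‖α ^ 2 + β * γ‖) (hα : 0 ≤ (conj δ * α).re) {n : ℝ} {f : ℂ}
    (hf : conicForm (α ^ 2 + β * γ) (blockTrace α β γ) f =
      conicDisc (α ^ 2 + β * γ) (blockTrace α β γ) * n ^ 2)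
    (hx : 0 ≤ (conj δ * f).re) :
    ∃ p q : ℂ, blockNorm p q = n ∧ blockForm α β γ p q = f := by
  have hD := conicDisc_pos hM
  obtain ⟨T, w, rfl, hw⟩ := exists_light α β γ f hD.ne'
  rw [hf] at hw
  have hw := mul_left_cancel₀ hD.ne' hw
  rcases le_total 0 T with hT | hT
  · obtain ⟨p, q, h1, h2, h3⟩ := exists_spinor hw hT
    exact ⟨p, q, h1, by rw [blockForm_eq, h2, h3]⟩
  -- For `T ≤ 0` the block attains `-f`, and `blockForm_re_pos` contradicts the sign of `Re (δ̄ f)`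
  -- unless the vector is zero.
  · obtain ⟨p, q, h1, h2, h3⟩ := exists_spinor (n := -n) (T := -T) (w := -w)
      (by rw [Complex.normSq_neg]; linarith) (by linarith)
    have h4 : blockForm α β γ p q = -(α * T + (β * w - γ * conj w) / 2) := by
      rw [blockForm_eq, h2, h3]; simp; ring
    by_cases h0 : (p, q) = 0
    · obtain ⟨rfl, rfl⟩ := Prod.mk_eq_zero.1 h0
      refine ⟨0, 0, ?_, ?_⟩
      · simp [blockNorm] at h1 ⊢
        linarith
      · have h5 : blockForm α β γ 0 0 = 0 := by simp [blockForm]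
        rw [h5, eq_comm, neg_eq_zero] at h4
        rw [h5, h4]
    · have := blockForm_re_pos hδ hM hα h0
      rw [h4, mul_neg, Complex.neg_re] at this
      linarith

/-! ### Three-dimensional Minkowski geometry -/

/-- Linear coordinates `x`, `y` which, together with the first projection, identify `ℝ × ℂ` with
the Minkowski space `ℝ³` whose time coordinate is `x`. -/
structure LorentzCoords where
  x : ℝ × ℂ →ₗ[ℝ] ℝ
  y : ℝ × ℂ →ₗ[ℝ] ℝ
  inj : ∀ r : ℝ × ℂ, x r = 0 → y r = 0 → r.1 = 0 → r = 0
  surj : ∀ a b c : ℝ, ∃ r : ℝ × ℂ, x r = a ∧ y r = b ∧ r.1 = c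

namespace LorentzCoords

variable (C : LorentzCoords)

/-- The Minkowski form. -/
def bil (r s : ℝ × ℂ) : ℝ := C.x r * C.x s - C.y r * C.y s - r.1 * s.1

/-- The closed future cone. -/
def Future (r : ℝ × ℂ) : Prop := 0 ≤ C.x r ∧ 0 ≤ C.bil r r

/-- The future light cone. -/
def Light (r : ℝ × ℂ) : Prop := 0 ≤ C.x r ∧ C.bil r r = 0

/-- The open future cone. -/
def Timelike (r : ℝ × ℂ) : Prop := 0 < C.x r ∧ 0 < C.bil r r

variable {C}

theorem Light.smul {r : ℝ × ℂ} (h : C.Light r) {c : ℝ} (hc : 0 ≤ c) : C.Light (c • r) := by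
  refine ⟨by rw [map_smul]; exact mul_nonneg hc h.1, ?_⟩
  have : C.bil (c • r) (c • r) = c ^ 2 * C.bil r r := by simp [bil]; ring
  rw [this, h.2, mul_zero]

theorem cauchy_aux {a b c d : ℝ} : (a * c + b * d) ^ 2 ≤ (a ^ 2 + b ^ 2) * (c ^ 2 + d ^ 2) := by
  nlinarith [sq_nonneg (a * d - b * c)]

theorem Future.bil_nonneg {r s : ℝ × ℂ} (hr : C.Future r) (hs : C.Future s) : 0 ≤ C.bil r s := by
  obtain ⟨h1, h2⟩ := hr
  obtain ⟨h3, h4⟩ := hs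
  unfold bil at *
  have h5 : |C.y r * C.y s + r.1 * s.1| ≤ C.x r * C.x s := by
    apply abs_le_of_sq_le_sq _ (mul_nonneg h1 h3)
    refine cauchy_aux.trans ?_
    rw [mul_pow]
    apply mul_le_mul <;> nlinarith
  linarith [le_abs_self (C.y r * C.y s + r.1 * s.1)]

/-- A nonzero vector orthogonal to a timelike vector is spacelike. -/
theorem Timelike.spacelike {r d : ℝ × ℂ} (hr : C.Timelike r) (hd : C.bil r d = 0) (h0 : d ≠ 0) :
    C.bil d d < 0 := by
  obtain ⟨h1, h2⟩ := hr
  unfold bil at *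
  by_contra! h
  have h3 : (C.x r * C.x d) ^ 2 ≤ (C.y r ^ 2 + r.1 ^ 2) * (C.y d ^ 2 + d.1 ^ 2) := by
    rw [show C.x r * C.x d = C.y r * C.y d + r.1 * d.1 by linarith]
    exact cauchy_aux
  have h4 : C.y d ^ 2 + d.1 ^ 2 ≤ C.x d ^ 2 := by nlinarith
  have h5 : C.y r ^ 2 + r.1 ^ 2 < C.x r ^ 2 := by nlinarith
  have h6 : C.x d = 0 := by
    by_contra h7
    have h8 : 0 < C.x d ^ 2 := by positivity
    have : (C.y r ^ 2 + r.1 ^ 2) * (C.y d ^ 2 + d.1 ^ 2) ≤ (C.y r ^ 2 + r.1 ^ 2) * C.x d ^ 2 :=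
      mul_le_mul_of_nonneg_left h4 (by positivity)
    nlinarith
  rw [h6] at h4
  exact h0 (C.inj d h6 (by nlinarith [sq_nonneg (C.y d), sq_nonneg d.1])
    (by nlinarith [sq_nonneg (C.y d), sq_nonneg d.1]))

theorem Timelike.light_of_bil_pos {r s : ℝ × ℂ} (hr : C.Timelike r) (hs : C.bil s s = 0)
    (h : 0 < C.bil r s) : C.Light s := by
  refine ⟨?_, hs⟩
  obtain ⟨h1, h2⟩ := hr
  unfold bil at *
  by_contra! h3
  have h4 := cauchy_aux (a := C.y r) (b := r.1) (c := C.y s) (d := s.1)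
  have h5 : C.y s ^ 2 + s.1 ^ 2 = C.x s ^ 2 := by linarith
  rw [h5] at h4
  have h6 : 0 < -(C.x r * C.x s) := by nlinarith
  have h7 : (C.x r * C.x s) ^ 2 < (C.y r * C.y s + r.1 * s.1) ^ 2 := by nlinarith
  nlinarith [sq_nonneg (C.x s)]

/-- A timelike vector is the mean of two light vectors in any given plane through it. -/
theorem Timelike.exists_light {r d : ℝ × ℂ} (hr : C.Timelike r) (hd : ∀ c : ℝ, d ≠ c • r) :
    ∃ (s t : ℝ), C.Light ((1 + t) • r + s • d) ∧ C.Light ((1 - t) • r - s • d) ∧ s ≠ 0 := by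
  -- Up to scale `u` is the component of `d` orthogonal to `r`, hence spacelike; the line `r + c u`
  -- meets the light cone at `c = ±m`.
  set u := C.bil r r • d - C.bil r d • r with hu
  have h1 : C.bil r u = 0 := by
    have : C.bil r u = C.bil r r * C.bil r d - C.bil r d * C.bil r r := by
      rw [hu]; simp [bil]; ring
    rw [this]; ring
  have h2 : u ≠ 0 := by
    intro h
    apply hd ((C.bil r r)⁻¹ * C.bil r d)
    rw [mul_smul, ← sub_eq_zero.1 h, smul_smul, inv_mul_cancel₀ hr.2.ne', one_smul]
  have h3 := hr.spacelike h1 h2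
  set m := √(C.bil r r / -C.bil u u) with hm
  have hm2 : m ^ 2 * -C.bil u u = C.bil r r := by
    rw [hm, Real.sq_sqrt (div_nonneg hr.2.le (by linarith)), div_mul_cancel₀ _ (by linarith)]
  have h4 : ∀ c : ℝ, c ^ 2 = m ^ 2 → C.Light (r + c • u) := by
    intro c hc
    have e1 : C.bil (r + c • u) (r + c • u) = C.bil r r + 2 * c * C.bil r u + c ^ 2 * C.bil u u := by
      simp [bil]; ring
    have e2 : C.bil r (r + c • u) = C.bil r r + c * C.bil r u := by
      simp [bil]; ring
    apply hr.light_of_bil_pos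
    · rw [e1, h1, hc]; linarith
    · rw [e2, h1]; linarith [hr.2]
  have hm0 : m ≠ 0 := by
    intro h
    rw [h] at hm2
    linarith [hr.2]
  refine ⟨m * C.bil r r, -(m * C.bil r d), ?_, ?_, mul_ne_zero hm0 hr.2.ne'⟩
  · convert h4 m rfl using 1
    rw [hu]; module
  · convert h4 (-m) (by ring) using 1
    rw [hu]; module

theorem Timelike.exists_light_fst {r : ℝ × ℂ} (hr : C.Timelike r) :
    ∃ s t : ℝ × ℂ, C.Light s ∧ C.Light t ∧ s.1 = r.1 ∧ t.1 = r.1 ∧ s + t = (2 : ℝ) • r := by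
  -- Exchanging the two coordinates of `r` makes `d` orthogonal to `r` with first component zero.
  -- Orthogonality forces `t = 0` below, so both light vectors keep the first component of `r`.
  obtain ⟨d, hx, hy, hn⟩ := C.surj (C.y r) (C.x r) 0
  have h0 : ∀ c : ℝ, d ≠ c • r := by
    rintro c rfl
    simp only [map_smul, smul_eq_mul] at hx hy
    have h1 := hr.1
    have h2 := hr.2
    unfold bil at h2
    have hy0 : C.y r = 0 := by
      have : (1 - c ^ 2) * C.y r = 0 := by linear_combination -c * hy - hx
      rcases mul_eq_zero.1 this with h | h
      · have : C.x r ^ 2 = C.y r ^ 2 := by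
          rw [← hx, mul_pow, show c ^ 2 = 1 by linarith]; ring
        nlinarith [sq_nonneg r.1]
      · exact h
    rw [hy0] at hy
    linarith
  have h1 : C.bil r d = 0 := by simp [bil, hx, hy, hn]; ring
  obtain ⟨s, t, hs, ht, -⟩ := hr.exists_light h0
  have e : ((1 + t) ^ 2 - (1 - t) ^ 2) * C.bil r r = 0 := by
    have e1 : C.bil ((1 + t) • r + s • d) ((1 + t) • r + s • d) =
      (1 + t) ^ 2 * C.bil r r + 2 * (1 + t) * s * C.bil r d + s ^ 2 * C.bil d d := by
      simp [bil]; ring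
    have e2 : C.bil ((1 - t) • r - s • d) ((1 - t) • r - s • d) =
      (1 - t) ^ 2 * C.bil r r - 2 * (1 - t) * s * C.bil r d + s ^ 2 * C.bil d d := by
      simp [bil]; ring
    have e3 := hs.2
    have e4 := ht.2
    rw [e1, h1] at e3
    rw [e2, h1] at e4
    linarith
  have ht0 : t = 0 := by
    rcases mul_eq_zero.1 e with h | h
    · linarith
    · exact absurd h hr.2.ne'
  subst ht0
  refine ⟨_, _, hs, ht, ?_, ?_, ?_⟩
  · simp [hn]
  · simp [hn]
  · module

open Filter Topology

/-- The derivative of the form along `v` is `2 * C.bil r v`: a boundary vector enters the open cone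
in any direction on the positive side of its tangent plane. -/
theorem Future.eventually_timelike {r v : ℝ × ℂ} (hr : C.Future r) (h0 : r ≠ 0)
    (hv : 0 < C.bil r r ∨ 0 < C.bil r v) : ∀ᶠ ε : ℝ in 𝓝[>] 0, C.Timelike (r + ε • v) := by
  have hx : 0 < C.x r := by
    obtain ⟨h1, h2⟩ := hr
    rcases h1.lt_or_eq with h | h
    · exact h
    · exfalso
      unfold bil at h2
      rw [← h] at h2
      exact h0 (C.inj r h.symm (by nlinarith [sq_nonneg (C.y r), sq_nonneg r.1])
        (by nlinarith [sq_nonneg (C.y r), sq_nonneg r.1]))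
  have e1 : ∀ ε : ℝ, C.bil (r + ε • v) (r + ε • v) =
      C.bil r r + ε * (2 * C.bil r v + ε * C.bil v v) := by
    intro ε; simp [bil]; ring
  have l1 : ∀ᶠ ε : ℝ in 𝓝[>] 0, 0 < C.x (r + ε • v) := by
    apply eventually_nhdsWithin_of_eventually_nhds
    have : Tendsto (fun ε : ℝ => C.x r + ε * C.x v) (𝓝 0) (𝓝 (C.x r + 0 * C.x v)) :=
      (by fun_prop : Continuous fun ε : ℝ => C.x r + ε * C.x v).tendsto 0
    have := this.eventually (lt_mem_nhds (a := 0) (by simpa using hx))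
    simpa using this
  have l2 : ∀ᶠ ε : ℝ in 𝓝[>] 0, 0 < C.bil (r + ε • v) (r + ε • v) := by
    rcases hv with h | h
    · apply eventually_nhdsWithin_of_eventually_nhds
      have : Tendsto (fun ε : ℝ => C.bil r r + ε * (2 * C.bil r v + ε * C.bil v v)) (𝓝 0)
          (𝓝 (C.bil r r + 0 * (2 * C.bil r v + 0 * C.bil v v))) :=
        (by fun_prop : Continuous fun ε : ℝ =>
          C.bil r r + ε * (2 * C.bil r v + ε * C.bil v v)).tendsto 0
      have := this.eventually (lt_mem_nhds (a := 0) (by simpa using h))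
      simpa only [e1] using this
    · have : Tendsto (fun ε : ℝ => 2 * C.bil r v + ε * C.bil v v) (𝓝 0)
          (𝓝 (2 * C.bil r v + 0 * C.bil v v)) :=
        (by fun_prop : Continuous fun ε : ℝ => 2 * C.bil r v + ε * C.bil v v).tendsto 0
      have := eventually_nhdsWithin_of_eventually_nhds (s := Set.Ioi 0)
        (this.eventually (lt_mem_nhds (a := 0) (by simpa using h)))
      filter_upwards [this, self_mem_nhdsWithin] with ε h3 h4
      rw [e1]
      have := mul_pos (Set.mem_Ioi.1 h4) h3
      linarith [hr.2]
  filter_upwards [l1, l2] with ε h1 h2 using ⟨h1, h2⟩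

theorem exists_bil_ne (r : ℝ × ℂ) (h0 : r ≠ 0) (hr : C.Light r) : ∃ s, C.Light s ∧ C.bil r s ≠ 0 := by
  -- Reversing space but not time turns `C.bil r s` into a Euclidean sum of squares.
  obtain ⟨s, h1, h2, h3⟩ := C.surj (C.x r) (-C.y r) (-r.1)
  refine ⟨s, ⟨h1 ▸ hr.1, ?_⟩, ?_⟩
  · rw [← hr.2]; simp [bil, h1, h2, h3]
  · intro h
    simp only [bil, h1, h2, h3] at h
    exact h0 (C.inj r (by nlinarith [sq_nonneg (C.y r), sq_nonneg r.1, sq_nonneg (C.x r)])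
      (by nlinarith [sq_nonneg (C.y r), sq_nonneg r.1, sq_nonneg (C.x r)])
      (by nlinarith [sq_nonneg (C.y r), sq_nonneg r.1, sq_nonneg (C.x r)]))

/-- The linear functional `bil r`. -/
def bilLin (C : LorentzCoords) (r : ℝ × ℂ) : ℝ × ℂ →ₗ[ℝ] ℝ :=
  C.x r • C.x - C.y r • C.y - r.1 • LinearMap.fst ℝ ℝ ℂ

@[simp] theorem bilLin_apply (r s : ℝ × ℂ) : C.bilLin r s = C.bil r s := by
  simp [bilLin, bil]

end LorentzCoords

/-! ### Sums of vectors from two future cones -/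

/-- Two functionals that never have strictly opposite signs are positively proportional. -/
theorem exists_pos_smul_eq {E : Type*} [AddCommGroup E] [Module ℝ E] {φ ψ : E →ₗ[ℝ] ℝ}
    (hφ : φ ≠ 0) (hψ : ψ ≠ 0) (h : ∀ v, 0 < φ v → 0 ≤ ψ v) : ∃ c : ℝ, 0 < c ∧ φ = c • ψ := by
  obtain ⟨v₁, hv₁⟩ : ∃ v, ψ v ≠ 0 := by
    by_contra! h'
    exact hψ (LinearMap.ext h')
  set v₀ := (-(ψ v₁)⁻¹) • v₁ with hv₀
  have h1 : ψ v₀ = -1 := by rw [hv₀, map_smul, smul_eq_mul]; field_simp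
  clear_value v₀
  -- A vector `u` of the kernel of `ψ` with `φ u ≠ 0` could be added to `v₀` to make `φ` equal to 1
  -- while `ψ` stays at -1.
  have hker : ∀ u, ψ u = 0 → φ u = 0 := by
    intro u hu
    by_contra hne
    have := h (v₀ + ((1 - φ v₀) / φ u) • u) (by
      rw [map_add, map_smul, smul_eq_mul, div_mul_cancel₀ _ hne]; linarith)
    rw [map_add, map_smul, hu, h1, smul_zero] at this
    linarith
  have heq : ∀ v, φ v = -φ v₀ * ψ v := by
    intro v
    have := hker (v + ψ v • v₀) (by rw [map_add, map_smul, h1, smul_eq_mul]; ring)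
    rw [map_add, map_smul, smul_eq_mul] at this
    linarith
  refine ⟨-φ v₀, ?_, LinearMap.ext heq⟩
  have h2 : φ v₀ ≤ 0 := by
    by_contra! h3
    linarith [h v₀ h3]
  rcases h2.lt_or_eq with h3 | h3
  · linarith
  · exfalso
    apply hφ
    ext v
    all_goals rw [heq, h3]; simp

/-- Among planar vectors with a sum on the axis, two can be combined to that sum. -/
theorem exists_pair {ι : Type*} [Fintype ι] (n m : ι → ℝ) {N : ℝ} (hN : 0 < N)
    (hn : ∑ i, n i = N) (hm : ∑ i, m i = 0) :
    ∃ (i j : ι) (a b : ℝ), 0 < a ∧ 0 < b ∧ a * n i + b * n j = N ∧ a * m i + b * m j = 0 := by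
  classical
  -- Otherwise vectors on the axis have `n ≤ 0`, and any pair above and below it has a nonpositive
  -- determinant `m i * n j - m j * n i`. Summing the determinants over all such pairs contradicts
  -- the total `(N, 0)`.
  by_contra! hbad
  set P := Finset.univ.filter fun i => 0 < m i with hP
  set Q := Finset.univ.filter fun i => m i < 0 with hQ
  set Z := Finset.univ.filter fun i => m i = 0 with hZ
  have split : ∀ f : ι → ℝ, ∑ i, f i = ∑ i ∈ P, f i + ∑ i ∈ Q, f i + ∑ i ∈ Z, f i := by
    intro f
    rw [hP, hQ, hZ, Finset.sum_filter, Finset.sum_filter, Finset.sum_filter,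
      ← Finset.sum_add_distrib, ← Finset.sum_add_distrib]
    refine Finset.sum_congr rfl fun i _ => ?_
    rcases lt_trichotomy (m i) 0 with h | h | h
    · simp [h, h.ne, h.le.not_gt]
    · simp [h]
    · simp [h, h.ne', h.le.not_gt]
  have hZn : ∑ i ∈ Z, n i ≤ 0 := by
    refine Finset.sum_nonpos fun i hi => ?_
    by_contra! hpos
    have hmi : m i = 0 := (Finset.mem_filter.1 hi).2
    refine hbad i i (N / (2 * n i)) (N / (2 * n i)) (by positivity) (by positivity) ?_ ?_
    · field_simp; ring
    · rw [hmi]; ring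
  have hPQ : ∀ i ∈ P, ∀ j ∈ Q, m i * n j - m j * n i ≤ 0 := by
    intro i hi j hj
    have hmi : 0 < m i := (Finset.mem_filter.1 hi).2
    have hmj : m j < 0 := (Finset.mem_filter.1 hj).2
    by_contra! hpos
    refine hbad i j (-m j * (N / (m i * n j - m j * n i))) (m i * (N / (m i * n j - m j * n i)))
      (mul_pos (by linarith) (by positivity)) (by positivity) ?_ ?_
    · have : -m j * (N / (m i * n j - m j * n i)) * n i + m i * (N / (m i * n j - m j * n i)) * n j =
        N / (m i * n j - m j * n i) * (m i * n j - m j * n i) := by ring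
      rw [this, div_mul_cancel₀ _ hpos.ne']
    · ring
  have hsum : ∑ i ∈ P, ∑ j ∈ Q, (m i * n j - m j * n i) ≤ 0 :=
    Finset.sum_nonpos fun i hi => Finset.sum_nonpos fun j hj => hPQ i hi j hj
  have hsum' : ∑ i ∈ P, ∑ j ∈ Q, (m i * n j - m j * n i) =
      (∑ i ∈ P, m i) * (∑ j ∈ Q, n j) - (∑ j ∈ Q, m j) * (∑ i ∈ P, n i) := by
    simp only [Finset.sum_sub_distrib, Finset.sum_mul_sum]
    congr 1
    rw [Finset.sum_comm]
  have hmZ : ∑ i ∈ Z, m i = 0 := Finset.sum_eq_zero fun i hi => (Finset.mem_filter.1 hi).2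
  rw [split, hmZ] at hm
  rw [split] at hn
  have hQm : ∑ j ∈ Q, m j = -∑ i ∈ P, m i := by linarith
  rw [hsum', hQm] at hsum
  have hS : 0 ≤ ∑ i ∈ P, m i := Finset.sum_nonneg fun i hi => (Finset.mem_filter.1 hi).2.le
  rcases hS.lt_or_eq with h | h
  · have : (∑ i ∈ P, m i) * (∑ i ∈ P, n i + ∑ j ∈ Q, n j) ≤ 0 := by linarith
    have := nonpos_of_mul_nonpos_right this h
    linarith
  · have hPe : P = ∅ := by
      by_contra hne
      exact (Finset.sum_pos (fun i hi => (Finset.mem_filter.1 hi).2)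
        (Finset.nonempty_iff_ne_empty.2 hne)).ne h
    have hQe : Q = ∅ := by
      by_contra hne
      have := Finset.sum_neg (f := m) (fun i hi => (Finset.mem_filter.1 hi).2)
        (Finset.nonempty_iff_ne_empty.2 hne)
      linarith
    simp [hPe, hQe] at hn
    linarith

open Filter Topology

theorem eventually_quadratic_ne_zero {a b c : ℝ} (h : a ≠ 0 ∨ b ≠ 0 ∨ c ≠ 0) :
    ∀ᶠ ε : ℝ in 𝓝[>] 0, a + b * ε + c * ε ^ 2 ≠ 0 := by
  by_cases ha : a = 0
  · by_cases hb : b = 0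
    · have hc : c ≠ 0 := by tauto
      filter_upwards [self_mem_nhdsWithin] with ε hε
      have : ε ≠ 0 := ne_of_gt hε
      rw [ha, hb]
      simp [hc, this]
    · have h1 : Tendsto (fun ε : ℝ => b + c * ε) (𝓝 0) (𝓝 (b + c * 0)) :=
        (by fun_prop : Continuous fun ε : ℝ => b + c * ε).tendsto 0
      have h2 := eventually_nhdsWithin_of_eventually_nhds (s := Set.Ioi 0)
        (h1.eventually_ne (b₂ := 0) (by simpa using hb))
      filter_upwards [h2, self_mem_nhdsWithin] with ε h3 hε
      have : ε ≠ 0 := ne_of_gt hε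
      have e : a + b * ε + c * ε ^ 2 = ε * (b + c * ε) := by rw [ha]; ring
      rw [e]
      exact mul_ne_zero this h3
  · have h1 : Tendsto (fun ε : ℝ => a + b * ε + c * ε ^ 2) (𝓝 0) (𝓝 (a + b * 0 + c * 0 ^ 2)) :=
      (by fun_prop : Continuous fun ε : ℝ => a + b * ε + c * ε ^ 2).tendsto 0
    exact eventually_nhdsWithin_of_eventually_nhds (h1.eventually_ne (b₂ := 0) (by simpa using ha))

namespace LorentzCoords

variable {C C₁ C₂ : LorentzCoords}

theorem bil_add_smul (r v : ℝ × ℂ) (ε : ℝ) : C.bil (r + ε • v) (r + ε • v) =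
    C.bil r r + (2 * C.bil r v) * ε + C.bil v v * ε ^ 2 := by
  simp [bil]; ring

theorem eventually_bil_ne_zero (r v : ℝ × ℂ) (h : C.bil r r ≠ 0 ∨ C.bil v v ≠ 0) :
    ∀ᶠ ε : ℝ in 𝓝[>] 0, C.bil (r + ε • v) (r + ε • v) ≠ 0 := by
  simp only [bil_add_smul]
  exact eventually_quadratic_ne_zero (by tauto)

/-- A direction at infinity that is asymptotic to neither of the two cones. -/
theorem exists_direction (C₁ C₂ : LorentzCoords) :
    ∃ v : ℝ × ℂ, v.1 = 0 ∧ C₁.bil v v ≠ 0 ∧ C₂.bil v v ≠ 0 := by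
  obtain ⟨u, hu1, hu2, hu3⟩ := C₁.surj 1 0 0
  obtain ⟨w, hw1, hw2, hw3⟩ := C₂.surj 1 0 0
  -- As polynomials in `ε`, the first form has a nonzero constant term and the second a nonzero
  -- leading coefficient, so neither vanishes for small `ε > 0`.
  have h1 := eventually_bil_ne_zero (C := C₁) u w (Or.inl (by simp [bil, hu1, hu2, hu3]))
  have h2 := eventually_bil_ne_zero (C := C₂) u w (Or.inr (by simp [bil, hw1, hw2, hw3]))
  obtain ⟨ε, h3, h4⟩ := (h1.and h2).exists
  exact ⟨u + ε • w, by simp [hu3, hw3], h3, h4⟩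

/-- The light vectors in the plane of `k` and `g` on which a timelike vector depends. -/
theorem Timelike.exists_light_plane {k g : ℝ × ℂ} (hk : k.1 ≠ 0) (hg : g.1 = 0)
    (hg' : C.bil g g ≠ 0) {ν c : ℝ} (hc : c ≠ 0) (h : C.Timelike (ν • k + c • g)) :
    ∃ ν₁ m₁ ν₂ m₂ : ℝ, C.Light (ν₁ • k + m₁ • g) ∧ C.Light (ν₂ • k + m₂ • g) ∧ ν₁ ≠ 0 ∧ ν₂ ≠ 0 ∧
      ν₁ + ν₂ = 2 * ν ∧ m₁ + m₂ = 2 * c := by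
  have hg0 : g ≠ 0 := by
    rintro rfl
    simp [bil] at hg'
  have h0 : ∀ b : ℝ, k ≠ b • (ν • k + c • g) := by
    intro b hb
    have h1 : k.1 = b * (ν * k.1) := by
      conv_lhs => rw [hb]
      simp [hg]
    have h2 : b * ν = 1 := by
      apply mul_right_cancel₀ hk
      linarith
    have h3 : (b * c) • g = 0 := by
      have h4 : b • (ν • k + c • g) = (b * ν) • k + (b * c) • g := by module
      rw [h4, h2, one_smul] at hb
      simpa using hb
    have hb0 : b ≠ 0 := by
      rintro rfl
      simp at h2
    exact hg0 ((smul_eq_zero.1 h3).resolve_left (mul_ne_zero hb0 hc))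
  obtain ⟨s, t, h1, h2, hs⟩ := h.exists_light h0
  -- A light vector without `k`-component is a multiple of `g`, which is not isotropic, hence it is
  -- zero.
  have key : ∀ ν' m' : ℝ, C.Light (ν' • k + m' • g) → ν' = 0 → m' = 0 := by
    rintro ν' m' hl rfl
    have := hl.2
    rw [zero_smul, zero_add] at this
    have e : C.bil (m' • g) (m' • g) = m' ^ 2 * C.bil g g := by simp [bil]; ring
    rw [e] at this
    simpa [hg'] using this
  have e1 : (1 + t) • (ν • k + c • g) + s • k = ((1 + t) * ν + s) • k + ((1 + t) * c) • g := by
    module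
  have e2 : (1 - t) • (ν • k + c • g) - s • k = ((1 - t) * ν - s) • k + ((1 - t) * c) • g := by
    module
  rw [e1] at h1
  rw [e2] at h2
  refine ⟨_, _, _, _, h1, h2, ?_, ?_, by ring, by ring⟩
  · intro h3
    have h4 := (mul_eq_zero.1 (key _ _ h1 h3)).resolve_right hc
    rw [h4] at h3
    exact hs (by linarith)
  · intro h3
    have h4 := (mul_eq_zero.1 (key _ _ h2 h3)).resolve_right hc
    rw [h4] at h3
    exact hs (by linarith)

/-- Moving `ε v` from one summand to the other preserves the sum and makes the direction at infinity
`g` of their plane isotropic for neither cone. Each summand is then half a sum of two light vectors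
of the plane of `k` and `g`, and `exists_pair` reduces the four to two. -/
theorem exists_light_add_of_timelike {k₁ k₂ : ℝ × ℂ} (h₁ : C₁.Timelike k₁) (h₂ : C₂.Timelike k₂)
    (hn : (k₁ + k₂).1 ≠ 0) :
    ∃ r s : ℝ × ℂ, (C₁.Light r ∨ C₂.Light r) ∧ (C₁.Light s ∨ C₂.Light s) ∧ r.1 ≠ 0 ∧ s.1 ≠ 0 ∧
      r + s = k₁ + k₂ := by
  have timelike_ne : ∀ {C : LorentzCoords} {k}, C.Timelike k → k ≠ 0 := by
    rintro C k h rfl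
    have := h.1
    simp at this
  set k := k₁ + k₂ with hk
  obtain ⟨v, hv0, hv1, hv2⟩ := exists_direction C₁ C₂
  set g₀ := k₁ - (k₁.1 / k.1) • k with hg₀
  have hg₀1 : g₀.1 = 0 := by
    simp only [hg₀, Prod.fst_sub, Prod.smul_fst, smul_eq_mul]
    field_simp
    ring
  have f1 := (show C₁.Future k₁ from ⟨h₁.1.le, h₁.2.le⟩).eventually_timelike (v := v)
    (timelike_ne h₁) (Or.inl h₁.2)
  have f2 := (show C₂.Future k₂ from ⟨h₂.1.le, h₂.2.le⟩).eventually_timelike (v := -v)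
    (timelike_ne h₂) (Or.inl h₂.2)
  have f3 := eventually_bil_ne_zero (C := C₁) g₀ v (Or.inr hv1)
  have f4 := eventually_bil_ne_zero (C := C₂) g₀ v (Or.inr hv2)
  obtain ⟨ε, e1, e2, e3, e4⟩ := (f1.and (f2.and (f3.and f4))).exists
  set g := g₀ + ε • v with hg
  have hg1 : g.1 = 0 := by simp [hg, hg₀1, hv0]
  have d1 : k₁ + ε • v = (k₁.1 / k.1) • k + (1 : ℝ) • g := by rw [hg, hg₀]; module
  have d2 : k₂ + ε • -v = (1 - k₁.1 / k.1) • k + (-1 : ℝ) • g := by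
    have : k₂ = k - k₁ := by rw [hk]; abel
    rw [hg, hg₀, this]; module
  rw [d1] at e1
  rw [d2] at e2
  obtain ⟨ν₁, m₁, ν₂, m₂, l1, l2, z1, z2, s1, s2⟩ :=
    e1.exists_light_plane hn hg1 e3 one_ne_zero
  obtain ⟨ν₃, m₃, ν₄, m₄, l3, l4, z3, z4, s3, s4⟩ :=
    e2.exists_light_plane hn hg1 e4 (neg_ne_zero.2 one_ne_zero)
  have hl : ∀ i : Fin 4, (C₁.Light ((![ν₁, ν₂, ν₃, ν₄] i) • k + (![m₁, m₂, m₃, m₄] i) • g) ∨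
      C₂.Light ((![ν₁, ν₂, ν₃, ν₄] i) • k + (![m₁, m₂, m₃, m₄] i) • g)) ∧
      ![ν₁, ν₂, ν₃, ν₄] i ≠ 0 := by
    intro i
    fin_cases i
    · exact ⟨Or.inl l1, z1⟩
    · exact ⟨Or.inl l2, z2⟩
    · exact ⟨Or.inr l3, z3⟩
    · exact ⟨Or.inr l4, z4⟩
  -- The four vectors add up to `2 k`: the `k`-coefficients to 2, the `g`-coefficients to 0.
  obtain ⟨i, j, a, b, ha, hb, hN, hM⟩ := exists_pair ![ν₁, ν₂, ν₃, ν₄] ![m₁, m₂, m₃, m₄] (N := 2)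
    two_pos (by simp [Fin.sum_univ_four]; linarith) (by simp [Fin.sum_univ_four]; linarith)
  obtain ⟨hi, hi0⟩ := hl i
  obtain ⟨hj, hj0⟩ := hl j
  set νi := ![ν₁, ν₂, ν₃, ν₄] i
  set νj := ![ν₁, ν₂, ν₃, ν₄] j
  set mi := ![m₁, m₂, m₃, m₄] i
  set mj := ![m₁, m₂, m₃, m₄] j
  have ha2 : 0 < a / 2 := by positivity
  have hb2 : 0 < b / 2 := by positivity
  refine ⟨(a / 2) • (νi • k + mi • g), (b / 2) • (νj • k + mj • g),
    hi.imp (fun h => h.smul ha2.le) (fun h => h.smul ha2.le),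
    hj.imp (fun h => h.smul hb2.le) (fun h => h.smul hb2.le), ?_, ?_, ?_⟩
  · simp [hg1, hi0, hn, ha.ne']
  · simp [hg1, hj0, hn, hb.ne']
  · have : (a / 2) • (νi • k + mi • g) + (b / 2) • (νj • k + mj • g) =
      ((a * νi + b * νj) / 2) • k + ((a * mi + b * mj) / 2) • g := by module
    rw [this, hN, hM]; simp

theorem Future.exists_light_add {k : ℝ × ℂ} (h : C.Future k) (hn : k.1 ≠ 0) :
    ∃ r s : ℝ × ℂ, C.Light r ∧ C.Light s ∧ r.1 ≠ 0 ∧ s.1 ≠ 0 ∧ r + s = k := by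
  have hhalf : ((2 : ℝ)⁻¹ • k).1 ≠ 0 := by simpa using hn
  rcases h.2.lt_or_eq with h1 | h1
  · have hx : 0 < C.x k := by
      apply h.1.lt_of_ne
      intro h2
      have := h1
      unfold bil at this
      rw [← h2] at this
      nlinarith [sq_nonneg (C.y k), sq_nonneg k.1]
    obtain ⟨s, t, hs, ht, hs1, ht1, hst⟩ := Timelike.exists_light_fst ⟨hx, h1⟩
    refine ⟨(2 : ℝ)⁻¹ • s, (2 : ℝ)⁻¹ • t, hs.smul (by norm_num), ht.smul (by norm_num), ?_, ?_, ?_⟩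
    · simpa [hs1] using hn
    · simpa [ht1] using hn
    · rw [← smul_add, hst, smul_smul]; norm_num
  · have hl : C.Light ((2 : ℝ)⁻¹ • k) := Light.smul ⟨h.1, h1.symm⟩ (by norm_num)
    exact ⟨_, _, hl, hl, hhalf, hhalf, by module⟩

/-- An element of the sum of two future cones is the sum of two vectors on light cones,
with nonzero first components, unless a common tangent plane prevents this. -/
theorem exists_light_add {k₁ k₂ : ℝ × ℂ} (h₁ : C₁.Future k₁) (h₂ : C₂.Future k₂)
    (hn : (k₁ + k₂).1 ≠ 0)
    (htan : k₁ ≠ 0 → k₂ ≠ 0 → C₁.Light k₁ → C₂.Light k₂ →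
      ∀ c : ℝ, 0 < c → C₁.bilLin k₁ = c • C₂.bilLin k₂ → (k₁.1 = 0 ↔ k₂.1 = 0)) :
    ∃ r s : ℝ × ℂ, (C₁.Light r ∨ C₂.Light r) ∧ (C₁.Light s ∨ C₂.Light s) ∧ r.1 ≠ 0 ∧ s.1 ≠ 0 ∧
      r + s = k₁ + k₂ := by
  by_cases z1 : k₁ = 0
  · subst z1
    rw [zero_add] at hn ⊢
    obtain ⟨r, s, hr, hs, h⟩ := h₂.exists_light_add hn
    exact ⟨r, s, Or.inr hr, Or.inr hs, h⟩
  by_cases z2 : k₂ = 0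
  · subst z2
    rw [add_zero] at hn ⊢
    obtain ⟨r, s, hr, hs, h⟩ := h₁.exists_light_add hn
    exact ⟨r, s, Or.inl hr, Or.inl hs, h⟩
  -- If no shift by a small `ε v` brings both summands into the open cones, both are light and their
  -- tangent functionals are positively proportional. Then `htan` excludes that just one first
  -- component vanishes, and not both can, by `hn`.
  suffices hmain : (∃ v, (0 < C₁.bil k₁ k₁ ∨ 0 < C₁.bil k₁ v) ∧
      (0 < C₂.bil k₂ k₂ ∨ 0 < C₂.bil k₂ (-v))) ∨
      (C₁.Light k₁ ∧ C₂.Light k₂ ∧ k₁.1 ≠ 0 ∧ k₂.1 ≠ 0) by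
    rcases hmain with ⟨v, hv1, hv2⟩ | ⟨l1, l2, n1, n2⟩
    · obtain ⟨ε, e1, e2⟩ := ((h₁.eventually_timelike z1 hv1).and
        (h₂.eventually_timelike z2 hv2)).exists
      have e : k₁ + ε • v + (k₂ + ε • -v) = k₁ + k₂ := by module
      rw [← e] at hn ⊢
      exact exists_light_add_of_timelike e1 e2 hn
    · exact ⟨k₁, k₂, Or.inl l1, Or.inr l2, n1, n2, rfl⟩
  have hneg : ∀ v, C₂.bil k₂ (-v) = -C₂.bil k₂ v := by
    intro v
    rw [← bilLin_apply, map_neg, bilLin_apply]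
  by_contra! hcon
  obtain ⟨hc1, hc2⟩ := hcon
  have l2 : C₂.Light k₂ := by
    refine ⟨h₂.1, ?_⟩
    by_contra hne
    have hp : 0 < C₂.bil k₂ k₂ := lt_of_le_of_ne h₂.2 (Ne.symm hne)
    have a1 : C₁.Light k₁ := by
      refine ⟨h₁.1, ?_⟩
      by_contra hne'
      exact absurd hp (hc1 0 (Or.inl (lt_of_le_of_ne h₁.2 (Ne.symm hne')))).1.not_gt
    obtain ⟨s, -, hs⟩ := exists_bil_ne k₁ z1 a1
    rcases hs.lt_or_gt with h | h
    · have := (hc1 (-s) (Or.inr (by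
        rw [← bilLin_apply, map_neg, bilLin_apply]; linarith))).1
      linarith
    · linarith [(hc1 s (Or.inr h)).1]
  have l1 : C₁.Light k₁ := by
    refine ⟨h₁.1, ?_⟩
    by_contra hne
    have hp : 0 < C₁.bil k₁ k₁ := lt_of_le_of_ne h₁.2 (Ne.symm hne)
    obtain ⟨s, -, hs⟩ := exists_bil_ne k₂ z2 l2
    have a := (hc1 s (Or.inl hp)).2
    have b := (hc1 (-s) (Or.inl hp)).2
    rw [hneg] at a b
    rw [hneg] at b
    exact hs (by linarith)
  obtain ⟨s1, -, hs1⟩ := exists_bil_ne k₁ z1 l1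
  obtain ⟨s2, -, hs2⟩ := exists_bil_ne k₂ z2 l2
  obtain ⟨c, hc, hcc⟩ := exists_pos_smul_eq (φ := C₁.bilLin k₁) (ψ := C₂.bilLin k₂)
    (fun h => hs1 (by rw [← bilLin_apply, h]; rfl)) (fun h => hs2 (by rw [← bilLin_apply, h]; rfl))
    (by
      intro v hv
      rw [bilLin_apply] at hv ⊢
      have := (hc1 v (Or.inr hv)).2
      rw [hneg] at this
      linarith)
  have hiff := htan z1 z2 l1 l2 c hc hcc
  by_cases n1 : k₁.1 = 0
  · apply hn
    rw [Prod.fst_add, n1, hiff.1 n1, add_zero]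
  · exact n1 (hiff.2 (hc2 l1 l2 n1))

end LorentzCoords

/-! ### The cone of a hyperbolic block -/

/-- The pair of `[v, v]_J` and `[B v, v]_J` for `J = diag(1, -1)`, `v = (p, q)` and the matrix `B`
with the rows `(a, b₁)` and `(b₃, b₂ - a)`. -/
def blockVec (a : ℝ) (b₁ b₂ b₃ p q : ℂ) : ℝ × ℂ :=
  (blockNorm p q, blockForm (a - b₂ / 2) b₁ b₃ p q + b₂ / 2 * blockNorm p q)

/-- The Minkowski coordinates in which the cone over the hyperbola with centre `c`, foci `c ± δ`
and parameter `M` is the light cone. -/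
def hyperbolaCoords (c δ : ℂ) (M : ℝ) (hM : |M| < 2 * ‖δ ^ 2‖) : LorentzCoords where
  x :=
    { toFun := fun r => 2 / √(‖δ ^ 2‖ * (2 * ‖δ ^ 2‖ + M)) * (conj δ * (r.2 - c * r.1)).re
      map_add' := fun r s => by simp; ring
      map_smul' := fun k r => by simp; ring }
  y :=
    { toFun := fun r => 2 / √(‖δ ^ 2‖ * (2 * ‖δ ^ 2‖ - M)) * (conj δ * (r.2 - c * r.1)).im
      map_add' := fun r s => by simp; ring
      map_smul' := fun k r => by simp; ring }
  inj := by
    rintro ⟨n, f⟩ hx hy hn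
    have h0 : 0 < ‖δ ^ 2‖ := by linarith [abs_nonneg M]
    obtain ⟨hM1, hM2⟩ := abs_lt.1 hM
    have h1 : √(‖δ ^ 2‖ * (2 * ‖δ ^ 2‖ + M)) ≠ 0 :=
      (Real.sqrt_pos.2 (mul_pos h0 (by linarith))).ne'
    have h2 : √(‖δ ^ 2‖ * (2 * ‖δ ^ 2‖ - M)) ≠ 0 :=
      (Real.sqrt_pos.2 (mul_pos h0 (by linarith))).ne'
    simp only at hn
    subst hn
    simp only [LinearMap.coe_mk, AddHom.coe_mk, mul_eq_zero, div_eq_zero_iff, h1, h2,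
      OfNat.ofNat_ne_zero, false_or, Complex.ofReal_zero, mul_zero, sub_zero] at hx hy
    have h3 : conj δ * f = 0 := Complex.ext hx hy
    have hδ : δ ≠ 0 := by
      rintro rfl
      simp at h0
    rw [mul_eq_zero, map_eq_zero] at h3
    rw [h3.resolve_left hδ]
    rfl
  surj := by
    intro u v n
    have h0 : 0 < ‖δ ^ 2‖ := by linarith [abs_nonneg M]
    obtain ⟨hM1, hM2⟩ := abs_lt.1 hM
    have h1 : √(‖δ ^ 2‖ * (2 * ‖δ ^ 2‖ + M)) ≠ 0 :=
      (Real.sqrt_pos.2 (mul_pos h0 (by linarith))).ne'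
    have h2 : √(‖δ ^ 2‖ * (2 * ‖δ ^ 2‖ - M)) ≠ 0 :=
      (Real.sqrt_pos.2 (mul_pos h0 (by linarith))).ne'
    have hδ : conj δ ≠ 0 := by
      rw [Ne, map_eq_zero]
      rintro rfl
      simp at h0
    refine ⟨(n, c * n + (⟨u * √(‖δ ^ 2‖ * (2 * ‖δ ^ 2‖ + M)) / 2,
      v * √(‖δ ^ 2‖ * (2 * ‖δ ^ 2‖ - M)) / 2⟩ : ℂ) / conj δ), ?_, ?_, rfl⟩
    · simp only [LinearMap.coe_mk, AddHom.coe_mk, add_sub_cancel_left, mul_div_cancel₀ _ hδ]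
      field_simp
    · simp only [LinearMap.coe_mk, AddHom.coe_mk, add_sub_cancel_left, mul_div_cancel₀ _ hδ]
      field_simp

section hyperbolaCoords

variable {c δ : ℂ} {M : ℝ} (hM : |M| < 2 * ‖δ ^ 2‖)

theorem hyperbolaCoords_x_nonneg (r : ℝ × ℂ) :
    0 ≤ (hyperbolaCoords c δ M hM).x r ↔ 0 ≤ (conj δ * (r.2 - c * r.1)).re := by
  have h0 : 0 < ‖δ ^ 2‖ := by linarith [abs_nonneg M]
  have h1 : 0 < √(‖δ ^ 2‖ * (2 * ‖δ ^ 2‖ + M)) :=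
    Real.sqrt_pos.2 (mul_pos h0 (by linarith [(abs_lt.1 hM).1]))
  exact mul_nonneg_iff_of_pos_left (by positivity)

/-- Multiplication by `conj δ` turns the focal axis into the real one and diagonalizes the conic.
Dividing by `conicDisc`, which is `(2‖δ²‖ - M)(2‖δ²‖ + M)`, yields the scalings of `x` and `y` in
`hyperbolaCoords`. -/
theorem conicForm_eq (f : ℂ) : ‖δ ^ 2‖ * conicForm (δ ^ 2) M f =
    4 * ((2 * ‖δ ^ 2‖ - M) * (conj δ * f).re ^ 2 - (2 * ‖δ ^ 2‖ + M) * (conj δ * f).im ^ 2) := by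
  rw [norm_pow, Complex.sq_norm, conicForm]
  simp only [Complex.normSq_apply, pow_two, Complex.mul_re, Complex.mul_im, Complex.conj_re,
    Complex.conj_im, map_mul]
  ring

theorem hyperbolaCoords_bil (r : ℝ × ℂ) :
    conicDisc (δ ^ 2) M * (hyperbolaCoords c δ M hM).bil r r =
      conicForm (δ ^ 2) M (r.2 - c * r.1) - conicDisc (δ ^ 2) M * r.1 ^ 2 := by
  have h0 : 0 < ‖δ ^ 2‖ := by linarith [abs_nonneg M]
  obtain ⟨hM1, hM2⟩ := abs_lt.1 hM
  have h1 : 0 < 2 * ‖δ ^ 2‖ + M := by linarith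
  have h2 : 0 < 2 * ‖δ ^ 2‖ - M := by linarith
  have hx : (hyperbolaCoords c δ M hM).x r * (hyperbolaCoords c δ M hM).x r =
      4 * (conj δ * (r.2 - c * r.1)).re ^ 2 / (‖δ ^ 2‖ * (2 * ‖δ ^ 2‖ + M)) := by
    change (2 / √_ * _) * (2 / √_ * _) = _
    have := Real.sq_sqrt (mul_pos h0 h1).le
    have h3 : √(‖δ ^ 2‖ * (2 * ‖δ ^ 2‖ + M)) ≠ 0 := (Real.sqrt_pos.2 (mul_pos h0 h1)).ne'
    conv_rhs => rw [← this]
    field_simp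
    ring
  have hy : (hyperbolaCoords c δ M hM).y r * (hyperbolaCoords c δ M hM).y r =
      4 * (conj δ * (r.2 - c * r.1)).im ^ 2 / (‖δ ^ 2‖ * (2 * ‖δ ^ 2‖ - M)) := by
    change (2 / √_ * _) * (2 / √_ * _) = _
    have := Real.sq_sqrt (mul_pos h0 h2).le
    have h3 : √(‖δ ^ 2‖ * (2 * ‖δ ^ 2‖ - M)) ≠ 0 := (Real.sqrt_pos.2 (mul_pos h0 h2)).ne'
    conv_rhs => rw [← this]
    field_simp
    ring
  have hf := conicForm_eq (δ := δ) (M := M) (r.2 - c * r.1)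
  have hf' : conicForm (δ ^ 2) M (r.2 - c * r.1) = 4 * ((2 * ‖δ ^ 2‖ - M) *
      (conj δ * (r.2 - c * r.1)).re ^ 2 - (2 * ‖δ ^ 2‖ + M) *
      (conj δ * (r.2 - c * r.1)).im ^ 2) / ‖δ ^ 2‖ := by
    rw [eq_div_iff h0.ne', ← hf]; ring
  rw [LorentzCoords.bil, hx, hy, hf', conicDisc]
  have h1' := h1.ne'
  have h2' := h2.ne'
  have h0' := h0.ne'
  generalize (conj δ * (r.2 - c * r.1)).re = X
  generalize (conj δ * (r.2 - c * r.1)).im = Y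
  generalize ‖δ ^ 2‖ = ρ at h0' h1' h2' ⊢
  rw [show 4 * ρ ^ 2 - M ^ 2 = (2 * ρ + M) * (2 * ρ - M) by ring]
  field_simp

end hyperbolaCoords

/-- The discriminant of the characteristic polynomial of the block, divided by four. -/
theorem DeltaPlus_eq (a : ℝ) (b₁ b₂ b₃ : ℂ) :
    DeltaPlus a b₁ b₂ b₃ = (a - b₂ / 2) ^ 2 + b₁ * b₃ := by
  rw [DeltaPlus, Delta]; ring

theorem MPlus_eq (a : ℝ) (b₁ b₂ b₃ : ℂ) :
    MPlus a b₁ b₂ b₃ = blockTrace (a - b₂ / 2) b₁ b₃ := by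
  rw [MPlus, M, blockTrace]
  simp only [Complex.sq_norm, Complex.normSq_apply]
  simp
  ring

theorem DeltaMinus_eq (a : ℝ) (b₁ b₂ b₃ : ℂ) :
    DeltaMinus a b₁ b₂ b₃ = DeltaPlus a b₁ (-b₂) b₃ := by
  rw [DeltaPlus, DeltaMinus]; ring

theorem MMinus_eq (a : ℝ) (b₁ b₂ b₃ : ℂ) : MMinus a b₁ b₂ b₃ = MPlus a b₁ (-b₂) b₃ := by
  rw [MPlus, MMinus]; simp

/-- The cone of the values of `blockVec`, in the hyperbolic case. -/
theorem exists_blockCoords {a : ℝ} {b₁ b₂ b₃ δ : ℂ} (hδ : δ ^ 2 = DeltaPlus a b₁ b₂ b₃)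
    (hM : |MPlus a b₁ b₂ b₃| < 2 * ‖DeltaPlus a b₁ b₂ b₃‖) :
    ∃ C : LorentzCoords,
      (∀ p q, C.Future (blockVec a b₁ b₂ b₃ p q)) ∧
      (∀ r, C.Light r → ∃ p q, blockVec a b₁ b₂ b₃ p q = r) ∧
      (∀ r, conicDisc (DeltaPlus a b₁ b₂ b₃) (MPlus a b₁ b₂ b₃) * C.bil r r =
        conicForm (DeltaPlus a b₁ b₂ b₃) (MPlus a b₁ b₂ b₃) (r.2 - b₂ / 2 * r.1) -
        conicDisc (DeltaPlus a b₁ b₂ b₃) (MPlus a b₁ b₂ b₃) * r.1 ^ 2) := by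
  rw [MPlus_eq, DeltaPlus_eq] at *
  -- The choice of the square root selects the nappe containing the values of the block.
  obtain ⟨ε, hε, hα⟩ := exists_orientation hδ
  have hD := conicDisc_pos hM
  have hM' : |blockTrace (a - b₂ / 2) b₁ b₃| < 2 * ‖ε ^ 2‖ := by rwa [hε]
  have hbil := fun r => hyperbolaCoords_bil (c := b₂ / 2) hM' r
  rw [hε] at hbil
  refine ⟨hyperbolaCoords (b₂ / 2) ε _ hM', ?_, ?_, hbil⟩
  · intro p q
    constructor
    · rw [hyperbolaCoords_x_nonneg]
      simp only [blockVec, add_sub_cancel_right]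
      by_cases h : (p, q) = 0
      · obtain ⟨rfl, rfl⟩ := Prod.mk_eq_zero.1 h
        simp [blockForm]
      · exact (blockForm_re_pos hε hM hα h).le
    · apply nonneg_of_mul_nonneg_right _ hD
      rw [hbil]
      simp only [blockVec, add_sub_cancel_right]
      linarith [conicDisc_mul_le (a - b₂ / 2) b₁ b₃ p q]
  · rintro ⟨n, f⟩ ⟨h1, h2⟩
    rw [hyperbolaCoords_x_nonneg] at h1
    have h3 := hbil (n, f)
    rw [h2, mul_zero] at h3
    obtain ⟨p, q, h4, h5⟩ := exists_blockForm_eq hε hM hα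
      (n := n) (f := f - b₂ / 2 * n) (by simp only at h3; linarith) h1
    exact ⟨p, q, by rw [blockVec, h4, h5]; simp⟩

/-! ### Common tangent planes of the two block cones -/

/-- The Hermitian form with the matrix `(A, c / 2; c̄ / 2, B)`. -/
def hermForm (A B : ℝ) (c p q : ℂ) : ℝ :=
  A * Complex.normSq p + B * Complex.normSq q + (c * (q * conj p)).re

/-- Completing the square shows that for `A > 0` a null vector satisfies `2 A p = -c q`. So `|p| /
|q|` does not depend on `B`, which makes null vectors of different blocks comparable. -/
theorem hermForm_psd {A B : ℝ} {c : ℂ} (h : ∀ p q, 0 ≤ hermForm A B c p q) :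
    0 ≤ A ∧ (A = 0 → c = 0) ∧
      ∀ p q, hermForm A B c p q = 0 → 4 * A ^ 2 * Complex.normSq p =
        Complex.normSq c * Complex.normSq q := by
  have hA : 0 ≤ A := by simpa [hermForm] using h 1 0
  have key : ∀ p q, 4 * A * hermForm A B c p q =
      Complex.normSq (2 * A * p + c * q) + (4 * A * B - Complex.normSq c) * Complex.normSq q := by
    intro p q
    simp [hermForm, Complex.normSq_apply]
    ring
  have hA0 : A = 0 → c = 0 := by
    rintro rfl
    by_contra hc
    have hc' : 0 < Complex.normSq c := Complex.normSq_pos.2 hc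
    have h1 := h (-((((|B| + 1) / Complex.normSq c : ℝ) : ℂ) * c)) 1
    have h2 : (c * (1 * conj (-((((|B| + 1) / Complex.normSq c : ℝ) : ℂ) * c)))).re =
        -(|B| + 1) := by
      rw [map_neg, map_mul, Complex.conj_ofReal]
      have : c * (1 * -((((|B| + 1) / Complex.normSq c : ℝ) : ℂ) * conj c)) =
          ((-((|B| + 1) / Complex.normSq c * Complex.normSq c) : ℝ) : ℂ) := by
        push_cast
        rw [← Complex.mul_conj c]; ring
      rw [this, Complex.ofReal_re, div_mul_cancel₀ _ hc'.ne']
    rw [hermForm, h2] at h1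
    simp at h1
    linarith [le_abs_self B]
  refine ⟨hA, hA0, ?_⟩
  intro p q hpq
  rcases hA.lt_or_eq with hp | h0
  · have h1 : 0 ≤ 4 * A * B - Complex.normSq c := by
      -- This vector annihilates the completed square and isolates the determinant.
      have h2 := key (-c) (2 * A)
      have h3 := mul_nonneg (mul_nonneg (by norm_num : (0 : ℝ) ≤ 4) hA) (h (-c) (2 * A))
      rw [h2] at h3
      have h4 : Complex.normSq (2 * (A : ℂ) * -c + c * (2 * A)) = 0 := by
        rw [Complex.normSq_eq_zero]; ring
      have h5 : Complex.normSq (2 * (A : ℂ)) = 4 * A ^ 2 := by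
        simp; ring
      rw [h4, h5, zero_add] at h3
      exact nonneg_of_mul_nonneg_left h3 (by positivity)
    have h2 := key p q
    rw [hpq, mul_zero] at h2
    have h3 := mul_nonneg h1 (Complex.normSq_nonneg q)
    have h4 : Complex.normSq (2 * A * p + c * q) = 0 :=
      le_antisymm (by linarith) (Complex.normSq_nonneg _)
    have h5 : 2 * A * p = -(c * q) := eq_neg_of_add_eq_zero_left (Complex.normSq_eq_zero.1 h4)
    have h6 := congrArg Complex.normSq h5
    rw [Complex.normSq_neg, Complex.normSq_mul, Complex.normSq_mul c] at h6
    have h7 : Complex.normSq (2 * (A : ℂ)) = 4 * A ^ 2 := by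
      simp; ring
    rwa [h7] at h6
  · rw [hA0 h0.symm, ← h0]; simp

/-- The order of the quantifiers is the point: `A` and `c` precede `b₂`, which enters only the
coefficient of `|q|²`. -/
theorem blockVec_functional (φ : ℝ × ℂ →ₗ[ℝ] ℝ) (a : ℝ) (b₁ b₃ : ℂ) :
    ∃ (A : ℝ) (c : ℂ), ∀ b₂ : ℂ, ∃ B : ℝ, ∀ p q,
      φ (blockVec a b₁ b₂ b₃ p q) = hermForm A B c p q := by
  refine ⟨φ (1, a), φ (0, b₁ - b₃) - φ (0, (b₁ + b₃) * Complex.I) * Complex.I, fun b₂ =>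
    ⟨φ (-1, a - b₂), fun p q => ?_⟩⟩
  set w := q * conj p with hw
  have h1 : blockVec a b₁ b₂ b₃ p q = Complex.normSq p • ((1 : ℝ), (a : ℂ)) +
      Complex.normSq q • ((-1 : ℝ), (a : ℂ) - b₂) + w.re • ((0 : ℝ), b₁ - b₃) +
      w.im • ((0 : ℝ), (b₁ + b₃) * Complex.I) := by
    have h2 : p * conj q = conj w := by rw [hw]; simp; ring
    have h3 : w = w.re + w.im * Complex.I := (Complex.re_add_im w).symm
    have h4 : conj w = w.re - w.im * Complex.I := by apply Complex.ext <;> simp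
    rw [blockVec, blockForm, h2, ← hw, h4]
    ext1
    · simp [blockNorm]; ring
    · simp only [blockNorm, Prod.snd_add, Prod.smul_snd, Complex.real_smul]
      push_cast
      linear_combination b₁ * h3
  rw [h1]
  simp only [map_add, map_smul, smul_eq_mul, hermForm, ← hw]
  simp
  ring

/-- Common tangents of the two cones touch them at vectors with the same kind of norm. -/
theorem blockVec_tangent {φ : ℝ × ℂ →ₗ[ℝ] ℝ} {a : ℝ} {b₁ b₂ b₂' b₃ p q p' q' : ℂ}
    (h : ∀ p q, 0 ≤ φ (blockVec a b₁ b₂ b₃ p q)) (h' : ∀ p q, 0 ≤ φ (blockVec a b₁ b₂' b₃ p q))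
    (h0 : φ (blockVec a b₁ b₂ b₃ p q) = 0) (h0' : φ (blockVec a b₁ b₂' b₃ p' q') = 0)
    (hpq : (p, q) ≠ 0) (hne : ∃ p q, φ (blockVec a b₁ b₂ b₃ p q) ≠ 0)
    (hn : blockNorm p q = 0) : blockNorm p' q' = 0 := by
  obtain ⟨A, c, hAc⟩ := blockVec_functional φ a b₁ b₃
  obtain ⟨B, hB⟩ := hAc b₂
  obtain ⟨B', hB'⟩ := hAc b₂'
  simp only [hB] at h h0 hne
  simp only [hB'] at h' h0'
  obtain ⟨hA, hA0, hz⟩ := hermForm_psd h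
  obtain ⟨-, -, hz'⟩ := hermForm_psd h'
  have e1 := hz p q h0
  have e2 := hz' p' q' h0'
  have hpq' : Complex.normSq p = Complex.normSq q := by rw [blockNorm] at hn; linarith
  have hq : Complex.normSq q ≠ 0 := by
    intro h1
    rw [h1] at hpq'
    exact hpq (Prod.ext (Complex.normSq_eq_zero.1 hpq') (Complex.normSq_eq_zero.1 h1))
  rw [hpq'] at e1
  have e3 := mul_right_cancel₀ hq e1
  rcases hA.lt_or_eq with hp | hA'
  · rw [← e3] at e2
    have := mul_left_cancel₀ (by positivity) e2
    rw [blockNorm, this, sub_self]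
  -- With `A = 0` the form is `B |q|²`; a null vector with `q ≠ 0` makes it vanish identically.
  · exfalso
    have hc := hA0 hA'.symm
    subst hc
    subst hA'
    have hB0 : B = 0 := by
      simp only [hermForm, zero_mul, zero_add, Complex.zero_re, add_zero] at h0
      exact (mul_eq_zero.1 h0).resolve_right hq
    obtain ⟨p, q, hne⟩ := hne
    apply hne
    simp [hermForm, hB0]

/-! ### Pseudo-convexity of the numerical range -/

section general

variable {n : Type} [Fintype n] {J A : Matrix n n ℂ}

theorem inner_add_smul (r s : ℂ) (x y z : n → ℂ) :
    inner J (r • x + s • y) z = r * inner J x z + s * inner J y z := by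
  simp [inner, Matrix.mulVec_add, Matrix.mulVec_smul, dotProduct_add, dotProduct_smul]

theorem inner_add_smul_right (r s : ℂ) (x y z : n → ℂ) :
    inner J z (r • x + s • y) = conj r * inner J z x + conj s * inner J z y := by
  simp [inner, add_dotProduct, smul_dotProduct]

theorem inner_conj (hJ : J.IsHermitian) (x y : n → ℂ) : conj (inner J x y) = inner J y x := by
  rw [inner, inner]
  conv_rhs => rw [Matrix.star_dotProduct, Matrix.star_mulVec, hJ.eq, ← Matrix.dotProduct_mulVec]
  rfl

theorem inner_self_ofReal (hJ : J.IsHermitian) (x : n → ℂ) :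
    ((inner J x x).re : ℂ) = inner J x x :=
  Complex.conj_eq_iff_re.1 (inner_conj hJ x x)

/-- Rescaling removes the normalization, and dividing by the `J`-norm merges the two signs. -/
theorem mem_numRange_iff (hJ : J.IsHermitian) (z : ℂ) :
    z ∈ numRange J A ↔ ∃ x : n → ℂ, (inner J x x).re ≠ 0 ∧
      inner J (A.mulVec x) x = z * (inner J x x).re := by
  constructor
  · rintro (⟨x, h1, h2⟩ | ⟨x, h1, h2⟩)
    · refine ⟨x, by simp [h1], ?_⟩
      rw [← h2, h1]; simp
    · refine ⟨x, by simp [h1], ?_⟩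
      rw [← h2, h1]; simp
  · rintro ⟨x, h1, h2⟩
    have hx := inner_self_ofReal hJ x
    set N := (inner J x x).re with hN
    have hscale : ∀ c : ℝ, inner J ((c : ℂ) • x) ((c : ℂ) • x) = ((c ^ 2 * N : ℝ) : ℂ) ∧
        inner J (A.mulVec ((c : ℂ) • x)) ((c : ℂ) • x) = z * ((c ^ 2 * N : ℝ) : ℂ) := by
      intro c
      have e1 := fun y => inner_add_smul (J := J) (c : ℂ) 0 y 0
      have e2 := fun y => inner_add_smul_right (J := J) (c : ℂ) 0 y 0
      simp only [smul_zero, add_zero, zero_mul, map_zero, Complex.conj_ofReal] at e1 e2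
      rw [Matrix.mulVec_smul, e1, e2, e1, e2, h2, ← hx]
      push_cast
      constructor <;> ring
    rcases h1.lt_or_gt with h | h
    · obtain ⟨e1, e2⟩ := hscale (√(-N))⁻¹
      have : (√(-N))⁻¹ ^ 2 * N = -1 := by
        rw [inv_pow, Real.sq_sqrt (by linarith)]; field_simp
      rw [this] at e1 e2
      refine Or.inl ⟨(((√(-N))⁻¹ : ℝ) : ℂ) • x, ?_, ?_⟩
      · rw [e1]; simp
      · rw [e2]; simp
    · obtain ⟨e1, e2⟩ := hscale (√N)⁻¹
      have : (√N)⁻¹ ^ 2 * N = 1 := by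
        rw [inv_pow, Real.sq_sqrt h.le]; field_simp
      rw [this] at e1 e2
      refine Or.inr ⟨(((√N)⁻¹ : ℝ) : ℂ) • x, ?_, ?_⟩
      · rw [e1]; simp
      · rw [e2]; simp

/-- A real binary quadratic form that is indefinite on the pencil of two others has a root at which
the denominator does not vanish. -/
theorem exists_binary_root {N₁ N₂ t κ ν : ℝ} (h1 : N₁ ≠ 0) (h : 0 < t * (1 - t) * (N₁ * N₂)) :
    ∃ r : ℝ, r ^ 2 * N₁ + r * κ = t * (r ^ 2 * N₁ + N₂ + r * ν) ∧
      r ^ 2 * N₁ + N₂ + r * ν ≠ 0 := by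
  have ht1 : 1 - t ≠ 0 := by
    intro h0
    rw [h0] at h
    simp at h
  set a := (1 - t) * N₁ with ha
  set b := κ - t * ν with hb
  set c := -(t * N₂) with hc
  have ha0 : a ≠ 0 := mul_ne_zero ht1 h1
  have hac : a * c < 0 := by rw [ha, hc]; nlinarith
  set d := √(b ^ 2 - 4 * a * c) with hd
  have hd0 : 0 < d := Real.sqrt_pos.2 (by nlinarith [sq_nonneg b])
  have hd2 : d ^ 2 = b ^ 2 - 4 * a * c := Real.sq_sqrt (by nlinarith [sq_nonneg b])
  have hroot : ∀ e : ℝ, e ^ 2 = d ^ 2 → a * ((-b + e) / (2 * a)) ^ 2 + b * ((-b + e) / (2 * a)) + c = 0 := by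
    intro e he
    field_simp
    nlinarith
  set r₁ := (-b + d) / (2 * a) with hr₁
  set r₂ := (-b + -d) / (2 * a) with hr₂
  have e1 := hroot d rfl
  have e2 := hroot (-d) (by ring)
  rw [← hr₁] at e1
  rw [← hr₂] at e2
  have hne : r₁ - r₂ ≠ 0 := by
    have : r₁ - r₂ = d / a := by rw [hr₁, hr₂]; field_simp; ring
    rw [this]
    exact div_ne_zero hd0.ne' ha0
  -- The signs of `a` and `c` are opposite, so the roots are distinct. If the denominator vanished
  -- at both, the two quadratics would be proportional, forcing `N₂ = 0`.
  by_contra! hcon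
  have n1 := hcon r₁ (by rw [ha, hb, hc] at e1; linarith)
  have n2 := hcon r₂ (by rw [ha, hb, hc] at e2; linarith)
  have f1 : N₁ * (r₁ + r₂) + ν = 0 := by
    apply mul_left_cancel₀ hne
    linear_combination n1 - n2
  have f2 : a * (r₁ + r₂) + b = 0 := by
    apply mul_left_cancel₀ hne
    linear_combination e1 - e2
  have g1 : N₁ * (r₁ * r₂) = N₂ := by linear_combination r₁ * f1 - n1
  have g2 : a * (r₁ * r₂) = c := by linear_combination r₁ * f2 - e1
  have g3 : N₂ = 0 := by
    have : (1 - t) * N₂ = -(t * N₂) := by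
      rw [ha, hc] at g2
      linear_combination g2 - (1 - t) * g1
    linarith
  rw [g3] at h
  simp at h

theorem exists_unit_phase (w : ℂ) : ∃ u : ℂ, u * conj u = 1 ∧ (u * w).im = 0 := by
  by_cases h : w = 0
  · exact ⟨1, by simp, by simp [h]⟩
  · have hw : (‖w‖ : ℂ) ≠ 0 := by exact_mod_cast norm_ne_zero_iff.2 h
    have e : conj w * w = (‖w‖ : ℂ) ^ 2 := by rw [mul_comm, Complex.mul_conj']
    refine ⟨conj w / ‖w‖, ?_, ?_⟩
    · rw [map_div₀, Complex.conj_conj, Complex.conj_ofReal, div_mul_div_comm, e]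
      field_simp
    · rw [div_mul_eq_mul_div, e, pow_two, mul_div_cancel_right₀ _ hw, Complex.ofReal_im]

/-- The numerical range is pseudo-convex. -/
theorem pseudoConvex_numRange (hJ : J.IsHermitian) {x y : n → ℂ} (hx : (inner J x x).re ≠ 0)
    (hy : (inner J y y).re ≠ 0) {t : ℝ}
    (ht : 0 ≤ t * (1 - t) * ((inner J x x).re * (inner J y y).re)) :
    t * point J A x + (1 - t) * point J A y ∈ numRange J A := by
  have hxN := inner_self_ofReal hJ x
  have hyN := inner_self_ofReal hJ y
  set N₁ := (inner J x x).re with hN₁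
  set N₂ := (inner J y y).re with hN₂
  have hx' : (N₁ : ℂ) ≠ 0 := by exact_mod_cast hx
  have hy' : (N₂ : ℂ) ≠ 0 := by exact_mod_cast hy
  have hz₁ : inner J (A.mulVec x) x = point J A x * N₁ := by
    rw [point, ← hxN, div_mul_cancel₀ _ hx']
  have hz₂ : inner J (A.mulVec y) y = point J A y * N₂ := by
    rw [point, ← hyN, div_mul_cancel₀ _ hy']
  set z₁ := point J A x
  set z₂ := point J A y
  have mem₁ : z₁ ∈ numRange J A := (mem_numRange_iff hJ _).2 ⟨x, hx, hz₁⟩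
  have mem₂ : z₂ ∈ numRange J A := (mem_numRange_iff hJ _).2 ⟨y, hy, hz₂⟩
  by_cases hz : z₁ = z₂
  · rw [hz, ← add_mul]; simpa using mem₂
  rcases ht.lt_or_eq with ht | ht
  swap
  · have : t * (1 - t) = 0 := by
      rcases mul_eq_zero.1 ht.symm with h | h
      · exact h
      · exact absurd h (mul_ne_zero hx hy)
    rcases mul_eq_zero.1 this with h | h
    · rw [h]; simpa using mem₂
    · have : t = 1 := by linarith
      rw [this]; simpa using mem₁
  have hd : z₁ - z₂ ≠ 0 := sub_ne_zero.2 hz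
  -- `P` and `Q` are the cross terms of `(A - z₂) / (z₁ - z₂)`, which moves the two points to 1 and
  -- 0. The phase `u` makes its form real on the vectors `r x + u y` with real `r`, so reaching `t`
  -- is one real quadratic equation.
  set P := (inner J (A.mulVec x) y - z₂ * inner J x y) / (z₁ - z₂) with hP
  set Q := (inner J (A.mulVec y) x - z₂ * inner J y x) / (z₁ - z₂) with hQ
  obtain ⟨u, hu, hu'⟩ := exists_unit_phase (Q - conj P)
  set κ := (conj u * P + u * Q).re with hκ
  have hκ' : (κ : ℂ) = conj u * P + u * Q := by
    apply Complex.conj_eq_iff_re.1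
    apply Complex.ext
    · simp
    · simp only [Complex.conj_im, Complex.add_im, Complex.mul_im, Complex.conj_re, Complex.sub_re,
        Complex.sub_im] at hu' ⊢
      linarith
  set ν := (conj u * inner J x y + u * inner J y x).re with hν
  have hν' : (ν : ℂ) = conj u * inner J x y + u * inner J y x := by
    apply Complex.conj_eq_iff_re.1
    rw [map_add, map_mul, map_mul, inner_conj hJ, inner_conj hJ, Complex.conj_conj]
    ring
  obtain ⟨r, h1, h2⟩ := exists_binary_root (κ := κ) (ν := ν) hx ht
  have eN : inner J ((r : ℂ) • x + u • y) ((r : ℂ) • x + u • y) =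
      ((r ^ 2 * N₁ + N₂ + r * ν : ℝ) : ℂ) := by
    rw [inner_add_smul, inner_add_smul_right, inner_add_smul_right, ← hxN, ← hyN,
      Complex.conj_ofReal]
    push_cast
    rw [hν']
    linear_combination (N₂ : ℂ) * hu
  have eP : inner J (A.mulVec x) y = P * (z₁ - z₂) + z₂ * inner J x y := by
    rw [hP, div_mul_cancel₀ _ hd]; ring
  have eQ : inner J (A.mulVec y) x = Q * (z₁ - z₂) + z₂ * inner J y x := by
    rw [hQ, div_mul_cancel₀ _ hd]; ring
  have eF : inner J (A.mulVec ((r : ℂ) • x + u • y)) ((r : ℂ) • x + u • y) =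
      (z₁ - z₂) * ((r ^ 2 * N₁ + r * κ : ℝ) : ℂ) + z₂ * ((r ^ 2 * N₁ + N₂ + r * ν : ℝ) : ℂ) := by
    rw [Matrix.mulVec_add, Matrix.mulVec_smul, Matrix.mulVec_smul, inner_add_smul,
      inner_add_smul_right, inner_add_smul_right, hz₁, hz₂, eP, eQ, Complex.conj_ofReal]
    push_cast
    rw [hν', hκ']
    linear_combination (z₂ * N₂ : ℂ) * hu
  refine (mem_numRange_iff hJ _).2 ⟨(r : ℂ) • x + u • y, ?_, ?_⟩
  · rw [eN, Complex.ofReal_re]; exact h2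
  · rw [eN, Complex.ofReal_re, eF, h1]
    push_cast
    ring

theorem pseudoConvexHull_subset (hJ : J.IsHermitian) (S : Set ℂ) :
    pseudoConvexHull J A S ⊆ numRange J A := by
  rintro z ⟨x, y, -, -, t, rfl, h⟩
  have h0 : (inner J x x).re * (inner J y y).re ≠ 0 := by
    rcases h with h | h
    · exact h.1.ne'
    · exact h.1.ne
  refine pseudoConvex_numRange hJ (left_ne_zero_of_mul h0) (right_ne_zero_of_mul h0) ?_
  rcases h with ⟨h1, h2, h3⟩ | ⟨h1, h2 | h2⟩
  · exact mul_nonneg (mul_nonneg h2 (by linarith)) h1.le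
  · exact mul_nonneg_of_nonpos_of_nonpos
      (mul_nonpos_of_nonpos_of_nonneg h2 (by linarith)) h1.le
  · exact mul_nonneg_of_nonpos_of_nonpos
      (mul_nonpos_of_nonneg_of_nonpos (by linarith) (by linarith)) h1.le

end general

/-! ### The numerical range as a sum of two cones -/

theorem J4_isHermitian : J4.IsHermitian := by
  rw [J4, Matrix.isHermitian_diagonal_iff]
  intro i
  fin_cases i <;> simp [IsSelfAdjoint]

/-- The vector of `ℂ⁴` with the symmetric part `(p, q)` and the antisymmetric part `(p', q')`. -/
def embed (p q p' q' : ℂ) : Fin 4 → ℂ := ![p + p', q + q', q - q', p - p']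

theorem exists_embed (x : Fin 4 → ℂ) : ∃ p q p' q', embed p q p' q' = x := by
  refine ⟨(x 0 + x 3) / 2, (x 1 + x 2) / 2, (x 0 - x 3) / 2, (x 1 - x 2) / 2, ?_⟩
  ext i
  fin_cases i <;> simp [embed] <;> ring

theorem inner_embed (p q p' q' : ℂ) : inner J4 (embed p q p' q') (embed p q p' q') =
    2 * ((blockNorm p q + blockNorm p' q' : ℝ) : ℂ) := by
  simp only [blockNorm]
  push_cast
  simp only [inner, J4, embed, dotProduct, Fin.sum_univ_four, Matrix.mulVec_diagonal,
    ← Complex.mul_conj]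
  simp
  ring

/-- Invariance under coordinate reversal removes the cross terms between the two parts; on them the
central entry `b₂` acts as `b₂` and `-b₂`. -/
theorem inner_A4_embed (a : ℝ) (b₁ b₂ b₃ p q p' q' : ℂ) :
    inner J4 ((A4 a b₁ b₂ b₃).mulVec (embed p q p' q')) (embed p q p' q') =
      2 * ((blockVec a b₁ b₂ b₃ p q).2 + (blockVec a b₁ (-b₂) b₃ p' q').2) := by
  simp only [blockVec, blockNorm, blockForm]
  push_cast
  simp only [inner, J4, embed, dotProduct, Fin.sum_univ_four, Matrix.mulVec_diagonal,
    ← Complex.mul_conj]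
  simp [A4, Matrix.mulVec, dotProduct, Fin.sum_univ_four]
  ring

theorem conicForm_real_mul (Δ : ℂ) (M c : ℝ) (f : ℂ) :
    conicForm Δ M (c * f) = c ^ 2 * conicForm Δ M f := by
  unfold conicForm
  rw [mul_pow, mul_left_comm, ← Complex.ofReal_pow, Complex.re_ofReal_mul, Complex.normSq_mul,
    Complex.normSq_ofReal]
  ring

theorem conicForm_div_sub (Δ : ℂ) (M : ℝ) (c : ℂ) {r : ℝ × ℂ} (hr : r.1 ≠ 0) :
    r.1 ^ 2 * conicForm Δ M (r.2 / r.1 - c) = conicForm Δ M (r.2 - c * r.1) := by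
  rw [← conicForm_real_mul]
  have : (r.1 : ℂ) ≠ 0 := by exact_mod_cast hr
  congr 1
  field_simp

theorem inner_A4_embed_zero_right (a : ℝ) (b₁ b₂ b₃ p q : ℂ) :
    inner J4 ((A4 a b₁ b₂ b₃).mulVec (embed p q 0 0)) (embed p q 0 0) =
      2 * (blockVec a b₁ b₂ b₃ p q).2 := by
  rw [inner_A4_embed]; simp [blockVec, blockForm, blockNorm]

theorem inner_A4_embed_zero_left (a : ℝ) (b₁ b₂ b₃ p q : ℂ) :
    inner J4 ((A4 a b₁ b₂ b₃).mulVec (embed 0 0 p q)) (embed 0 0 p q) =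
      2 * (blockVec a b₁ (-b₂) b₃ p q).2 := by
  rw [inner_A4_embed]; simp [blockVec, blockForm, blockNorm]

theorem blockVec_fst (a : ℝ) (b₁ b₂ b₃ p q : ℂ) : (blockVec a b₁ b₂ b₃ p q).1 = blockNorm p q := rfl

theorem inner_embed_zero_right (p q : ℂ) :
    inner J4 (embed p q 0 0) (embed p q 0 0) = 2 * (blockNorm p q : ℂ) := by
  rw [inner_embed]; simp [blockNorm]

theorem inner_embed_zero_left (p q : ℂ) :
    inner J4 (embed 0 0 p q) (embed 0 0 p q) = 2 * (blockNorm p q : ℂ) := by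
  rw [inner_embed]; simp [blockNorm]

theorem point_eq {r : ℝ × ℂ} {x : Fin 4 → ℂ} {A : Matrix (Fin 4) (Fin 4) ℂ}
    (h1 : inner J4 x x = 2 * (r.1 : ℂ)) (h2 : inner J4 (A.mulVec x) x = 2 * r.2) :
    point J4 A x = r.2 / r.1 := by
  rw [point, h1, h2, mul_div_mul_left _ _ two_ne_zero]

/-- The numerical range lies in the pseudo-convex hull of the two hyperbolas. -/
theorem numRange_subset_hull {a : ℝ} {b₁ b₂ b₃ : ℂ} {S : Set ℂ}
    (hM : |MPlus a b₁ b₂ b₃| < 2 * ‖DeltaPlus a b₁ b₂ b₃‖)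
    (hM' : |MPlus a b₁ (-b₂) b₃| < 2 * ‖DeltaPlus a b₁ (-b₂) b₃‖)
    (hS : ∀ z, conicForm (DeltaPlus a b₁ b₂ b₃) (MPlus a b₁ b₂ b₃) (z - b₂ / 2) =
      conicDisc (DeltaPlus a b₁ b₂ b₃) (MPlus a b₁ b₂ b₃) → z ∈ S)
    (hS' : ∀ z, conicForm (DeltaPlus a b₁ (-b₂) b₃) (MPlus a b₁ (-b₂) b₃) (z - -b₂ / 2) =
      conicDisc (DeltaPlus a b₁ (-b₂) b₃) (MPlus a b₁ (-b₂) b₃) → z ∈ S) :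
    numRange J4 (A4 a b₁ b₂ b₃) ⊆ pseudoConvexHull J4 (A4 a b₁ b₂ b₃) S := by
  obtain ⟨δ, hδ⟩ := IsAlgClosed.exists_pow_nat_eq (DeltaPlus a b₁ b₂ b₃) two_pos
  obtain ⟨δ', hδ'⟩ := IsAlgClosed.exists_pow_nat_eq (DeltaPlus a b₁ (-b₂) b₃) two_pos
  obtain ⟨C, hC1, hC2, hC4⟩ := exists_blockCoords hδ hM
  obtain ⟨C', hC1', hC2', hC4'⟩ := exists_blockCoords hδ' hM'
  have lightC : ∀ r, C.Light r → r.1 ≠ 0 → ∃ x : Fin 4 → ℂ, inner J4 x x = 2 * (r.1 : ℂ) ∧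
      inner J4 ((A4 a b₁ b₂ b₃).mulVec x) x = 2 * r.2 ∧ r.2 / r.1 ∈ S := by
    intro r hr h0
    obtain ⟨p, q, rfl⟩ := hC2 r hr
    refine ⟨embed p q 0 0, inner_embed_zero_right p q, inner_A4_embed_zero_right a b₁ b₂ b₃ p q, ?_⟩
    apply hS
    apply mul_left_cancel₀ (pow_ne_zero 2 h0)
    have := hC4 (blockVec a b₁ b₂ b₃ p q)
    rw [hr.2] at this
    rw [conicForm_div_sub _ _ _ h0]
    linarith
  have lightC' : ∀ r, C'.Light r → r.1 ≠ 0 → ∃ x : Fin 4 → ℂ, inner J4 x x = 2 * (r.1 : ℂ) ∧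
      inner J4 ((A4 a b₁ b₂ b₃).mulVec x) x = 2 * r.2 ∧ r.2 / r.1 ∈ S := by
    intro r hr h0
    obtain ⟨p, q, rfl⟩ := hC2' r hr
    refine ⟨embed 0 0 p q, inner_embed_zero_left p q, inner_A4_embed_zero_left a b₁ b₂ b₃ p q, ?_⟩
    apply hS'
    apply mul_left_cancel₀ (pow_ne_zero 2 h0)
    have := hC4' (blockVec a b₁ (-b₂) b₃ p q)
    rw [hr.2] at this
    rw [conicForm_div_sub _ _ _ h0]
    linarith
  intro z hz
  obtain ⟨x, hx0, hx⟩ := (mem_numRange_iff J4_isHermitian z).1 hz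
  obtain ⟨p, q, p', q', rfl⟩ := exists_embed x
  rw [inner_A4_embed, inner_embed] at hx
  rw [inner_embed] at hx0
  set k := blockVec a b₁ b₂ b₃ p q with hk
  set k' := blockVec a b₁ (-b₂) b₃ p' q' with hk'
  have hsum : (k + k').1 = blockNorm p q + blockNorm p' q' := rfl
  rw [← hsum] at hx0 hx
  have hn : (k + k').1 ≠ 0 := by
    intro h
    rw [h] at hx0
    simp at hx0
  have hz' : (k + k').2 = z * (k + k').1 := by
    have : (2 * ((k + k').1 : ℂ)).re = 2 * (k + k').1 := by simp
    rw [this] at hx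
    push_cast at hx
    rw [Prod.snd_add]
    linear_combination hx / 2
  obtain ⟨r, s, hr, hs, hr0, hs0, hrs⟩ := LorentzCoords.exists_light_add (hC1 p q) (hC1' p' q') hn (by
    -- The functional `C.bilLin k` is nonnegative on the values of both blocks and vanishes at both
    -- `k` and `k'`, so `blockVec_tangent` applies in both directions.
    intro z1 z2 l1 l2 c hc hcc
    have hp : (p, q) ≠ 0 := by
      intro h
      obtain ⟨rfl, rfl⟩ := Prod.mk_eq_zero.1 h
      apply z1
      simp [blockVec, blockForm, blockNorm]
    have hp' : (p', q') ≠ 0 := by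
      intro h
      obtain ⟨rfl, rfl⟩ := Prod.mk_eq_zero.1 h
      apply z2
      simp [blockVec, blockForm, blockNorm]
    have n1 : ∀ u v, 0 ≤ C.bilLin k (blockVec a b₁ b₂ b₃ u v) := by
      intro u v
      rw [LorentzCoords.bilLin_apply]
      exact (hC1 p q).bil_nonneg (hC1 u v)
    have n2 : ∀ u v, 0 ≤ C.bilLin k (blockVec a b₁ (-b₂) b₃ u v) := by
      intro u v
      rw [hcc, LinearMap.smul_apply, LorentzCoords.bilLin_apply]
      exact mul_nonneg hc.le ((hC1' p' q').bil_nonneg (hC1' u v))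
    have v1 : C.bilLin k k = 0 := by rw [LorentzCoords.bilLin_apply]; exact l1.2
    have v2 : C.bilLin k k' = 0 := by
      rw [hcc, LinearMap.smul_apply, LorentzCoords.bilLin_apply, l2.2, smul_zero]
    have w1 : ∃ u v, C.bilLin k (blockVec a b₁ b₂ b₃ u v) ≠ 0 := by
      obtain ⟨s, hs, hs'⟩ := LorentzCoords.exists_bil_ne k z1 l1
      obtain ⟨u, v, rfl⟩ := hC2 s hs
      exact ⟨u, v, by rwa [LorentzCoords.bilLin_apply]⟩
    have w2 : ∃ u v, C.bilLin k (blockVec a b₁ (-b₂) b₃ u v) ≠ 0 := by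
      obtain ⟨s, hs, hs'⟩ := LorentzCoords.exists_bil_ne k' z2 l2
      obtain ⟨u, v, rfl⟩ := hC2' s hs
      refine ⟨u, v, ?_⟩
      rw [hcc, LinearMap.smul_apply, LorentzCoords.bilLin_apply]
      exact mul_ne_zero hc.ne' hs'
    exact ⟨blockVec_tangent n1 n2 v1 v2 hp w1, blockVec_tangent n2 n1 v2 v1 hp' w2⟩)
  obtain ⟨x, hx1, hx2, hx3⟩ := hr.elim (fun h => lightC r h hr0) (fun h => lightC' r h hr0)
  obtain ⟨y, hy1, hy2, hy3⟩ := hs.elim (fun h => lightC s h hs0) (fun h => lightC' s h hs0)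
  rw [← hrs] at hn hz'
  have hr0' : (r.1 : ℂ) ≠ 0 := by exact_mod_cast hr0
  have hs0' : (s.1 : ℂ) ≠ 0 := by exact_mod_cast hs0
  have hn' : (r.1 : ℂ) + s.1 ≠ 0 := by
    rw [Prod.fst_add] at hn
    exact_mod_cast hn
  rw [Prod.snd_add, Prod.fst_add] at hz'
  push_cast at hz'
  -- `z` is the weighted mean of the two points with the weights `r.1` and `s.1`: equal signs give
  -- the segment, opposite signs the rays.
  refine ⟨x, y, by rwa [point_eq hx1 hx2], by rwa [point_eq hy1 hy2], r.1 / (r.1 + s.1), ?_, ?_⟩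
  · rw [point_eq hx1 hx2, point_eq hy1 hy2]
    push_cast
    apply mul_right_cancel₀ hn'
    rw [← hz']
    field_simp
    ring
  · have ex : (inner J4 x x).re = 2 * r.1 := by rw [hx1]; simp
    have ey : (inner J4 y y).re = 2 * s.1 := by rw [hy1]; simp
    rw [ex, ey]
    rw [Prod.fst_add] at hn
    have e1 : 1 - r.1 / (r.1 + s.1) = s.1 / (r.1 + s.1) := by field_simp; ring
    have e2 : r.1 / (r.1 + s.1) * (1 - r.1 / (r.1 + s.1)) = r.1 * s.1 / (r.1 + s.1) ^ 2 := by
      rw [e1]; field_simp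
    have e3 : 0 < (r.1 + s.1) ^ 2 := by positivity
    rcases (mul_ne_zero hr0 hs0).lt_or_gt with h | h
    · right
      refine ⟨by nlinarith, ?_⟩
      have := div_neg_of_neg_of_pos h e3
      rw [← e2] at this
      by_contra! hcon
      nlinarith [mul_pos hcon.1 (sub_pos.2 hcon.2)]
    · left
      have := div_pos h e3
      rw [← e2] at this
      refine ⟨by nlinarith, ?_, ?_⟩
      · by_contra! hcon; nlinarith
      · by_contra! hcon; nlinarith

/-- For `b₂ = 0` the numerical range is the hyperbolic disc of the common block. -/
theorem numRange_eq_of_zero {a : ℝ} {b₁ b₃ : ℂ}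
    (hM : |MPlus a b₁ 0 b₃| < 2 * ‖DeltaPlus a b₁ 0 b₃‖) (z : ℂ) :
    z ∈ numRange J4 (A4 a b₁ 0 b₃) ↔ conicDisc (DeltaPlus a b₁ 0 b₃) (MPlus a b₁ 0 b₃) ≤
      conicForm (DeltaPlus a b₁ 0 b₃) (MPlus a b₁ 0 b₃) z := by
  obtain ⟨δ, hδ⟩ := IsAlgClosed.exists_pow_nat_eq (DeltaPlus a b₁ 0 b₃) two_pos
  obtain ⟨C, hC1, hC2, hC4⟩ := exists_blockCoords hδ hM
  have hD := conicDisc_pos hM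
  have key : ∀ r : ℝ × ℂ, r.1 ≠ 0 → r.2 = z * r.1 → (0 ≤ C.bil r r ↔
      conicDisc (DeltaPlus a b₁ 0 b₃) (MPlus a b₁ 0 b₃) ≤
      conicForm (DeltaPlus a b₁ 0 b₃) (MPlus a b₁ 0 b₃) z) := by
    intro r hr hrz
    have h1 := hC4 r
    have h2 : r.2 - 0 / 2 * r.1 = r.1 * z := by rw [hrz]; ring
    rw [h2, conicForm_real_mul] at h1
    have h3 : 0 < r.1 ^ 2 := by positivity
    rw [← mul_nonneg_iff_of_pos_left hD, h1, mul_comm (conicDisc _ _), ← mul_sub,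
      mul_nonneg_iff_of_pos_left h3, sub_nonneg]
  rw [mem_numRange_iff J4_isHermitian]
  constructor
  · rintro ⟨x, hx0, hx⟩
    obtain ⟨p, q, p', q', rfl⟩ := exists_embed x
    rw [inner_A4_embed, inner_embed, neg_zero] at hx
    rw [inner_embed] at hx0
    set k := blockVec a b₁ 0 b₃ p q with hk
    set k' := blockVec a b₁ 0 b₃ p' q' with hk'
    have hsum : (k + k').1 = blockNorm p q + blockNorm p' q' := rfl
    rw [← hsum] at hx0 hx
    have hn : (k + k').1 ≠ 0 := by
      intro h
      rw [h] at hx0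
      simp at hx0
    have hz' : (k + k').2 = z * (k + k').1 := by
      have : (2 * ((k + k').1 : ℂ)).re = 2 * (k + k').1 := by simp
      rw [this] at hx
      push_cast at hx
      rw [Prod.snd_add]
      linear_combination hx / 2
    rw [← key _ hn hz']
    have e : C.bil (k + k') (k + k') = C.bil k k + 2 * C.bil k k' + C.bil k' k' := by
      simp [LorentzCoords.bil]; ring
    have h1 := (hC1 p q).2
    have h2 := (hC1 p' q').2
    have h3 := (hC1 p q).bil_nonneg (hC1 p' q')
    rw [e]
    linarith
  · intro h
    -- One of `±(1, z)` is in the future cone; it is a sum of two light vectors, one realized in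
    -- each copy of the block.
    obtain ⟨c, hc, hf⟩ : ∃ c : ℝ, c ≠ 0 ∧ C.Future (c • ((1 : ℝ), z)) := by
      have h1 := (key (1, z) one_ne_zero (by simp)).2 h
      rcases le_total 0 (C.x (1, z)) with h2 | h2
      · exact ⟨1, one_ne_zero, by rw [one_smul]; exact ⟨h2, h1⟩⟩
      · refine ⟨-1, by norm_num, ?_, ?_⟩
        · rw [map_smul, smul_eq_mul]; linarith
        · have : C.bil ((-1 : ℝ) • ((1 : ℝ), z)) ((-1 : ℝ) • ((1 : ℝ), z)) =
              C.bil (1, z) (1, z) := by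
            simp only [LorentzCoords.bil, map_smul, Prod.smul_fst, smul_eq_mul]; ring
          rw [this]; exact h1
    obtain ⟨r, s, hr, hs, -, -, hrs⟩ := hf.exists_light_add (by simpa using hc)
    obtain ⟨p, q, rfl⟩ := hC2 r hr
    obtain ⟨p', q', rfl⟩ := hC2 s hs
    have h1 : blockNorm p q + blockNorm p' q' = c := by
      have := congrArg Prod.fst hrs
      simpa [blockVec_fst] using this
    have h2 : (blockVec a b₁ 0 b₃ p q).2 + (blockVec a b₁ 0 b₃ p' q').2 = c * z := by
      have := congrArg Prod.snd hrs
      simpa using this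
    refine ⟨embed p q p' q', ?_, ?_⟩
    · rw [inner_embed, h1]; simpa using hc
    · rw [inner_A4_embed, neg_zero, h2, inner_embed, h1]
      have : (2 * (c : ℂ)).re = 2 * c := by simp
      rw [this]
      push_cast
      ring

/-! ### Examples: a flat portion and the whole plane -/

theorem abs_lt_two_mul_norm {M : ℝ} {Δ : ℂ} (h : M ^ 2 < 4 * Complex.normSq Δ) :
    |M| < 2 * ‖Δ‖ := by
  apply lt_of_pow_lt_pow_left₀ 2 (by positivity)
  rw [sq_abs, mul_pow, Complex.sq_norm]
  linarith

/-- As `b₂` is imaginary, the real part of the form is the same in both blocks, so the hyperbolas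
share the tangent `Re z = 3`, which they touch at the conjugate points `3 ∓ 2i/3`. -/
theorem bihyperbolic_flat : Bihyperbolic 5 4 (2 * Complex.I) (-4) := by
  have hI : (2 * Complex.I) ^ 2 = (-4 : ℂ) := by rw [mul_pow, Complex.I_sq]; norm_num
  refine ⟨by simp, ?_, ?_⟩
  · apply abs_lt_two_mul_norm
    rw [MPlus, M, DeltaPlus, Delta, hI, Complex.normSq_apply]
    norm_num
  · apply abs_lt_two_mul_norm
    rw [MMinus, M, DeltaMinus, Delta, hI, Complex.normSq_apply]
    norm_num

/-- The two differences are `2 |p + 2q|²` and `2 |2p + q|²`. The first vanishes at `(2, -1)`, the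
vector used in `flat_point`. -/
theorem three_mul_blockNorm_le {b₂ : ℂ} (hb : b₂.re = 0) (p q : ℂ) :
    |3 * blockNorm p q| ≤ (blockVec 5 4 b₂ (-4) p q).2.re := by
  rw [abs_le]
  simp [blockVec, blockForm, blockNorm, hb, Complex.normSq_apply]
  constructor <;> nlinarith [sq_nonneg (2 * p.re + q.re), sq_nonneg (2 * p.im + q.im),
    sq_nonneg (2 * q.re + p.re), sq_nonneg (2 * q.im + p.im)]

theorem three_le_abs_re {z : ℂ} (hz : z ∈ numRange J4 (A4 5 4 (2 * Complex.I) (-4))) :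
    3 ≤ |z.re| := by
  obtain ⟨x, hx0, hx⟩ := (mem_numRange_iff J4_isHermitian z).1 hz
  obtain ⟨p, q, p', q', rfl⟩ := exists_embed x
  rw [inner_A4_embed] at hx
  have h1 := three_mul_blockNorm_le (b₂ := 2 * Complex.I) (by simp) p q
  have h2 := three_mul_blockNorm_le (b₂ := -(2 * Complex.I)) (by simp) p' q'
  set N := (inner J4 (embed p q p' q') (embed p q p' q')).re with hN
  have hN' : N = 2 * (blockNorm p q + blockNorm p' q') := by
    rw [hN, inner_embed]; simp
  have h3 := congrArg Complex.re hx
  rw [Complex.re_mul_ofReal, Complex.mul_re, Complex.add_re] at h3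
  simp only [Complex.re_ofNat, Complex.im_ofNat, zero_mul, sub_zero] at h3
  have h4 : 3 * |N| ≤ |z.re| * |N| := by
    rw [← abs_mul, ← h3, hN']
    have h5 := abs_add_le (3 * blockNorm p q) (3 * blockNorm p' q')
    have h6 : 3 * |2 * (blockNorm p q + blockNorm p' q')| =
        2 * |3 * blockNorm p q + 3 * blockNorm p' q'| := by
      rw [← mul_add, abs_mul, abs_mul, abs_of_pos (zero_lt_two' ℝ),
        abs_of_pos (zero_lt_three' ℝ)]
      ring
    rw [h6]
    exact le_trans (by linarith) (le_abs_self _)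
  exact le_of_mul_le_mul_right h4 (abs_pos.2 hx0)

theorem flat_point (s : ℝ) (hs : 0 ≤ s) (hs' : s ≤ 1) :
    (s : ℂ) * (3 - 2 / 3 * Complex.I) + (1 - s) * (3 + 2 / 3 * Complex.I) ∈
      numRange J4 (A4 5 4 (2 * Complex.I) (-4)) := by
  have n : blockNorm 2 (-1) = 3 := by simp [blockNorm]; norm_num
  have x1 := inner_embed_zero_right 2 (-1)
  have y1 := inner_embed_zero_left 2 (-1)
  have x2 := inner_A4_embed_zero_right 5 4 (2 * Complex.I) (-4) 2 (-1)
  have y2 := inner_A4_embed_zero_left 5 4 (2 * Complex.I) (-4) 2 (-1)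
  rw [n] at x1 y1
  have px : point J4 (A4 5 4 (2 * Complex.I) (-4)) (embed 2 (-1) 0 0) =
      3 - 2 / 3 * Complex.I := by
    rw [point, x1, x2]
    simp only [blockVec, n]
    simp [blockForm, Complex.conj_ofNat]
    ring
  have py : point J4 (A4 5 4 (2 * Complex.I) (-4)) (embed 0 0 2 (-1)) =
      3 + 2 / 3 * Complex.I := by
    rw [point, y1, y2]
    simp only [blockVec, n]
    simp [blockForm, Complex.conj_ofNat]
    ring
  rw [← px, ← py]
  apply pseudoConvex_numRange J4_isHermitian
  · rw [x1]; norm_num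
  · rw [y1]; norm_num
  · rw [x1, y1]
    have := mul_nonneg hs (sub_nonneg.2 hs')
    norm_num
    exact this

theorem exists_flat_portion : ∃ (a : ℝ) (b₁ b₂ b₃ : ℂ), Bihyperbolic a b₁ b₂ b₃ ∧
    ∃ p q : ℂ, p ≠ q ∧ segment ℝ p q ⊆ frontier (numRange J4 (A4 a b₁ b₂ b₃)) := by
  refine ⟨5, 4, 2 * Complex.I, -4, bihyperbolic_flat, 3 - 2 / 3 * Complex.I,
    3 + 2 / 3 * Complex.I, ?_, ?_⟩
  · intro h
    have := congrArg Complex.im h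
    norm_num at this
  · rintro z ⟨s, t, hs, ht, hst, rfl⟩
    have ht' : t = 1 - s := by linarith
    subst ht'
    have hmem := flat_point s hs (by linarith)
    set z := s • (3 - 2 / 3 * Complex.I) + (1 - s) • (3 + 2 / 3 * Complex.I) with hz
    have hz' : (s : ℂ) * (3 - 2 / 3 * Complex.I) + (1 - s) * (3 + 2 / 3 * Complex.I) = z := by
      rw [hz, Complex.real_smul, Complex.real_smul]; push_cast; ring
    have hre : z.re = 3 := by
      rw [← hz']; simp; ring
    rw [hz'] at hmem
    refine ⟨subset_closure hmem, fun hint => ?_⟩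
    obtain ⟨ε, hε, hball⟩ := Metric.isOpen_iff.1 isOpen_interior z hint
    set e := min ε 1 / 2 with he
    have he0 : 0 < e := by positivity
    have he1 : e < ε := by
      have := min_le_left ε 1
      linarith
    have he2 : e ≤ 1 / 2 := by
      have := min_le_right ε 1
      linarith
    have h1 : z - e ∈ Metric.ball z ε := by
      rw [Metric.mem_ball, dist_eq_norm, sub_sub_cancel_left, norm_neg, Complex.norm_real,
        Real.norm_of_nonneg he0.le]
      exact he1
    have h2 := three_le_abs_re (interior_subset (hball h1))
    rw [Complex.sub_re, hre, Complex.ofReal_re, abs_of_nonneg (by linarith)] at h2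
    linarith

theorem exists_numRange_eq_univ : ∃ (a : ℝ) (b₁ b₂ b₃ : ℂ), Bihyperbolic a b₁ b₂ b₃ ∧
    numRange J4 (A4 a b₁ b₂ b₃) = Set.univ := by
  refine ⟨0, 1, 2, 0, ⟨two_ne_zero, ?_, ?_⟩, Set.eq_univ_of_forall fun z => ?_⟩
  · apply abs_lt_two_mul_norm
    rw [MPlus, M, DeltaPlus, Delta]
    norm_num
  · apply abs_lt_two_mul_norm
    rw [MMinus, M, DeltaMinus, Delta]
    norm_num
  · set Z := Complex.normSq z with hZ
    have hZ0 : 0 ≤ Z := Complex.normSq_nonneg z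
    -- The positive root of `P - 2 Z / P = 1`, the normalization of the vector below. Its first
    -- block contributes `z - 2 Z / P`, and the second is chosen to contribute `2 Z / P`.
    set P := (1 + √(1 + 8 * Z)) / 2 with hP
    have hs := Real.sq_sqrt (show 0 ≤ 1 + 8 * Z by linarith)
    have hP0 : 0 < P := by positivity
    have hP1 : P ^ 2 - P = 2 * Z := by rw [hP]; nlinarith
    set r := √P with hr
    have hr0 : r ≠ 0 := (Real.sqrt_pos.2 hP0).ne'
    have hr2 : r * r = P := Real.mul_self_sqrt hP0.le
    have hrc : (r : ℂ) ≠ 0 := by exact_mod_cast hr0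
    have n1 : Complex.normSq (z / r) = Z / P := by rw [Complex.normSq_div, Complex.normSq_ofReal, hr2]
    have n2 : Complex.normSq ((√Z / r : ℝ) : ℂ) = Z / P := by
      rw [Complex.normSq_ofReal, div_mul_div_comm, hr2, Real.mul_self_sqrt hZ0]
    have n3 : Complex.normSq (r : ℂ) = P := by rw [Complex.normSq_ofReal, hr2]
    have hN : blockNorm r (z / r) + blockNorm 0 ((√Z / r : ℝ) : ℂ) = 1 := by
      rw [blockNorm, blockNorm, n1, n2, n3, Complex.normSq_zero]
      field_simp
      linarith
    rw [mem_numRange_iff J4_isHermitian]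
    refine ⟨embed r (z / r) 0 ((√Z / r : ℝ) : ℂ), ?_, ?_⟩
    · rw [inner_embed, hN]; simp
    · rw [inner_A4_embed, inner_embed, hN]
      simp only [blockVec, blockForm, blockNorm, n1, n2, n3, Complex.conj_ofReal]
      simp
      field_simp
      ring

/-! ### Duals of conics and points in line coordinates -/

/-- The quadratic form `(w + x u + y v)² - (α u² + 2 β u v + γ v²)` in the line coordinates. -/
def conicPoly (x y α β γ : ℂ) : MvPolynomial (Fin 3) ℂ :=
  (X 2 + C x * X 0 + C y * X 1) ^ 2 -
    (C α * X 0 ^ 2 + C (2 * β) * (X 0 * X 1) + C γ * X 1 ^ 2)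

theorem eval_conicPoly (x y α β γ : ℂ) (ξ : Fin 3 → ℂ) : eval ξ (conicPoly x y α β γ) =
    (ξ 2 + x * ξ 0 + y * ξ 1) ^ 2 - (α * ξ 0 ^ 2 + 2 * β * (ξ 0 * ξ 1) + γ * ξ 1 ^ 2) := by
  simp [conicPoly]

theorem pderiv_zero_conicPoly (x y α β γ : ℂ) : pderiv 0 (conicPoly x y α β γ) =
    C (2 * x) * (X 2 + C x * X 0 + C y * X 1) - (C (2 * α) * X 0 + C (2 * β) * X 1) := by
  have h1 : pderiv (0 : Fin 3) (X 1 : MvPolynomial (Fin 3) ℂ) = 0 := pderiv_X_of_ne (by decide)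
  have h2 : pderiv (0 : Fin 3) (X 2 : MvPolynomial (Fin 3) ℂ) = 0 := pderiv_X_of_ne (by decide)
  have hC : C (2 : ℂ) = (2 : MvPolynomial (Fin 3) ℂ) := map_ofNat C 2
  simp only [conicPoly, map_sub, map_add, pderiv_pow, pderiv_mul, pderiv_C, pderiv_X_self, h1, h2]
  simp only [map_mul, hC]
  norm_num
  ring

theorem pderiv_one_conicPoly (x y α β γ : ℂ) : pderiv 1 (conicPoly x y α β γ) =
    C (2 * y) * (X 2 + C x * X 0 + C y * X 1) - (C (2 * β) * X 0 + C (2 * γ) * X 1) := by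
  have h1 : pderiv (1 : Fin 3) (X 0 : MvPolynomial (Fin 3) ℂ) = 0 := pderiv_X_of_ne (by decide)
  have h2 : pderiv (1 : Fin 3) (X 2 : MvPolynomial (Fin 3) ℂ) = 0 := pderiv_X_of_ne (by decide)
  have hC : C (2 : ℂ) = (2 : MvPolynomial (Fin 3) ℂ) := map_ofNat C 2
  simp only [conicPoly, map_sub, map_add, pderiv_pow, pderiv_mul, pderiv_C, pderiv_X_self, h1, h2]
  simp only [map_mul, hC]
  norm_num
  ring

theorem pderiv_two_conicPoly (x y α β γ : ℂ) : pderiv 2 (conicPoly x y α β γ) =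
    C 2 * (X 2 + C x * X 0 + C y * X 1) := by
  have h1 : pderiv (2 : Fin 3) (X 0 : MvPolynomial (Fin 3) ℂ) = 0 := pderiv_X_of_ne (by decide)
  have h2 : pderiv (2 : Fin 3) (X 1 : MvPolynomial (Fin 3) ℂ) = 0 := pderiv_X_of_ne (by decide)
  have hC : C (2 : ℂ) = (2 : MvPolynomial (Fin 3) ℂ) := map_ofNat C 2
  simp only [conicPoly, map_sub, map_add, pderiv_pow, pderiv_mul, pderiv_C, pderiv_X_self, h1, h2]
  simp only [map_mul, hC]
  norm_num

theorem gradient_conicPoly (x y α β γ : ℂ) (ξ : Fin 3 → ℂ) : gradient (conicPoly x y α β γ) ξ =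
    ![2 * x * (ξ 2 + x * ξ 0 + y * ξ 1) - (2 * α * ξ 0 + 2 * β * ξ 1),
      2 * y * (ξ 2 + x * ξ 0 + y * ξ 1) - (2 * β * ξ 0 + 2 * γ * ξ 1),
      2 * (ξ 2 + x * ξ 0 + y * ξ 1)] := by
  ext i
  fin_cases i
  · simp [gradient, pderiv_zero_conicPoly]
  · simp [gradient, pderiv_one_conicPoly]
  · simp [gradient, pderiv_two_conicPoly]

theorem gradient_C_mul (k : ℂ) (g : MvPolynomial (Fin 3) ℂ) (ξ : Fin 3 → ℂ) :
    gradient (C k * g) ξ = k • gradient g ξ := by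
  ext i
  simp [gradient]

theorem pderiv_eq_C_of_totalDegree_le_one {σ : Type*} {g : MvPolynomial σ ℂ}
    (h : g.totalDegree ≤ 1) (i : σ) : ∃ a : ℂ, pderiv i g = C a := by
  classical
  refine ⟨coeff 0 (pderiv i g), ?_⟩
  ext m
  rw [coeff_C]
  split_ifs with hm
  · rw [hm]
  · rw [coeff_pderiv, coeff_eq_zero_of_totalDegree_lt, zero_mul]
    refine lt_of_le_of_lt h ?_
    change 1 < (m + Finsupp.single i 1).degree
    rw [map_add, Finsupp.degree_single]
    have : m.degree ≠ 0 := fun h0 => hm ((Finsupp.degree_eq_zero_iff m).1 h0).symm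
    omega

theorem exists_eq_C_mul_of_dvd {f g : MvPolynomial (Fin 3) ℂ} (hf : f ≠ 0)
    (hf1 : f.totalDegree ≤ 1) (hg : Irreducible g) (h : g ∣ f) : ∃ k : ℂ, k ≠ 0 ∧ f = C k * g := by
  obtain ⟨r, rfl⟩ := h
  have hr0 : r ≠ 0 := right_ne_zero_of_mul hf
  rw [totalDegree_mul_of_isDomain hg.ne_zero hr0] at hf1
  have hg1 : g.totalDegree ≠ 0 := by
    intro h0
    obtain ha := totalDegree_eq_zero_iff_eq_C.1 h0
    refine hg.not_isUnit (isUnit_iff_totalDegree_of_isReduced.2 ⟨?_, h0⟩)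
    rw [isUnit_iff_ne_zero]
    intro hc
    rw [hc, C_0] at ha
    exact hg.ne_zero ha
  have hr1 := totalDegree_eq_zero_iff_eq_C.1 (show r.totalDegree = 0 by omega)
  refine ⟨coeff 0 r, ?_, by rw [← hr1, mul_comm]⟩
  intro hc
  rw [hc, C_0] at hr1
  exact hr0 hr1

/-- A nondegenerate quadratic form is irreducible, since its Hessian matrix is regular. -/
theorem irreducible_conicPoly {x y α β γ : ℂ} (h : α * γ - β ^ 2 ≠ 0) :
    Irreducible (conicPoly x y α β γ) := by
  have hQ0 : conicPoly x y α β γ ≠ 0 := by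
    intro h0
    have := eval_conicPoly x y α β γ ![0, 0, 1]
    rw [h0] at this
    simp at this
  refine irreducible_iff.2 ⟨?_, ?_⟩
  · intro hu
    have h1 := hu.map (eval (0 : Fin 3 → ℂ))
    rw [eval_conicPoly] at h1
    simp at h1
  · intro f g hfg
    have hf0 : f ≠ 0 := by
      rintro rfl
      exact hQ0 (by rw [hfg, zero_mul])
    have hg0 : g ≠ 0 := by
      rintro rfl
      exact hQ0 (by rw [hfg, mul_zero])
    have unit_of : ∀ {r : MvPolynomial (Fin 3) ℂ}, r ≠ 0 → r.totalDegree = 0 → IsUnit r := by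
      intro r hr0 hr
      have hr1 := totalDegree_eq_zero_iff_eq_C.1 hr
      refine isUnit_iff_totalDegree_of_isReduced.2 ⟨?_, hr⟩
      rw [isUnit_iff_ne_zero]
      intro hc
      rw [hc, C_0] at hr1
      exact hr0 hr1
    have hdeg : (conicPoly x y α β γ).totalDegree ≤ 2 := by
      have hX : ∀ (c : ℂ) (i : Fin 3), (C c * X i : MvPolynomial (Fin 3) ℂ).IsHomogeneous 1 :=
        fun c i => (isHomogeneous_X ℂ i).C_mul c
      apply IsHomogeneous.totalDegree_le
      exact ((((isHomogeneous_X ℂ 2).add (hX x 0)).add (hX y 1)).pow 2).sub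
        (((((isHomogeneous_X ℂ 0).pow 2).C_mul α).add
          (((isHomogeneous_X ℂ 0).mul (isHomogeneous_X ℂ 1)).C_mul (2 * β))).add
          (((isHomogeneous_X ℂ 1).pow 2).C_mul γ))
    by_contra! hcon
    have hf1 : f.totalDegree ≠ 0 := fun h0 => hcon.1 (unit_of hf0 h0)
    have hg1 : g.totalDegree ≠ 0 := fun h0 => hcon.2 (unit_of hg0 h0)
    rw [hfg, totalDegree_mul_of_isDomain hf0 hg0] at hdeg
    choose a ha using pderiv_eq_C_of_totalDegree_le_one (show f.totalDegree ≤ 1 by omega)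
    choose b hb using pderiv_eq_C_of_totalDegree_le_one (show g.totalDegree ≤ 1 by omega)
    -- Factors of degree one would give a Hessian `a bᵀ + b aᵀ` of rank at most two, whereas the
    -- determinant of the Hessian is `8 (α γ - β²)`.
    have hess : ∀ i j, eval 0 (pderiv i (pderiv j (conicPoly x y α β γ))) =
        a i * b j + a j * b i := by
      intro i j
      rw [hfg, pderiv_mul, map_add, pderiv_mul, pderiv_mul]
      simp only [ha, hb, pderiv_C]
      simp
      ring
    have h10 : pderiv (1 : Fin 3) (X 0 : MvPolynomial (Fin 3) ℂ) = 0 := pderiv_X_of_ne (by decide)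
    have h12 : pderiv (1 : Fin 3) (X 2 : MvPolynomial (Fin 3) ℂ) = 0 := pderiv_X_of_ne (by decide)
    have h01 : pderiv (0 : Fin 3) (X 1 : MvPolynomial (Fin 3) ℂ) = 0 := pderiv_X_of_ne (by decide)
    have h02 : pderiv (0 : Fin 3) (X 2 : MvPolynomial (Fin 3) ℂ) = 0 := pderiv_X_of_ne (by decide)
    have h20 : pderiv (2 : Fin 3) (X 0 : MvPolynomial (Fin 3) ℂ) = 0 := pderiv_X_of_ne (by decide)
    have h21 : pderiv (2 : Fin 3) (X 1 : MvPolynomial (Fin 3) ℂ) = 0 := pderiv_X_of_ne (by decide)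
    have e00 := hess 0 0
    have e01 := hess 1 0
    have e11 := hess 1 1
    have e02 := hess 0 2
    have e12 := hess 1 2
    have e22 := hess 2 2
    rw [pderiv_zero_conicPoly] at e00 e01
    rw [pderiv_one_conicPoly] at e11
    rw [pderiv_two_conicPoly] at e02 e12 e22
    simp only [map_sub, map_add, pderiv_mul, pderiv_C, h10, h12, h01, h02, h20, h21,
      pderiv_X_self, mul_zero, zero_mul, zero_add, add_zero] at e00 e01 e11 e02 e12 e22
    simp only [eval_C, map_mul, mul_one] at e00 e01 e11 e02 e12 e22
    apply h
    have key : (8 : ℂ) * (α * γ - β ^ 2) =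
        (2 * x * x - 2 * α) * ((2 * y * y - 2 * γ) * 2 - (2 * y) * (2 * y)) -
        (2 * x * y - 2 * β) * ((2 * x * y - 2 * β) * 2 - (2 * x) * (2 * y)) +
        (2 * x) * ((2 * x * y - 2 * β) * (2 * y) - (2 * x) * (2 * y * y - 2 * γ)) := by ring
    have h8 : (8 : ℂ) * (α * γ - β ^ 2) = 0 := by
      rw [key, e00, e01, e11, e02, e12]
      have : ∀ t : ℂ, t = a 2 * b 2 + a 2 * b 2 →
          (a 0 * b 0 + a 0 * b 0) * ((a 1 * b 1 + a 1 * b 1) * t -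
            (a 1 * b 2 + a 2 * b 1) * (a 1 * b 2 + a 2 * b 1)) -
          (a 1 * b 0 + a 0 * b 1) * ((a 1 * b 0 + a 0 * b 1) * t -
            (a 0 * b 2 + a 2 * b 0) * (a 1 * b 2 + a 2 * b 1)) +
          (a 0 * b 2 + a 2 * b 0) * ((a 1 * b 0 + a 0 * b 1) * (a 1 * b 2 + a 2 * b 1) -
            (a 0 * b 2 + a 2 * b 0) * (a 1 * b 1 + a 1 * b 1)) = 0 := by
        rintro t rfl; ring
      exact this 2 e22
    simpa using h8

/-- The gradient is an invertible linear map. Its inverse provides `u` and `v` below, so each point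
of the dual conic is itself a point of contact and the Zariski closure adds nothing. -/
theorem mem_dualCurve_conicPoly {x y α β γ k : ℂ} (h : α * γ - β ^ 2 ≠ 0) (hk : k ≠ 0)
    (P : Fin 3 → ℂ) : P ∈ dualCurve (C k * conicPoly x y α β γ) ↔
      γ * (P 0 - x * P 2) ^ 2 - 2 * β * (P 0 - x * P 2) * (P 1 - y * P 2) +
        α * (P 1 - y * P 2) ^ 2 = (α * γ - β ^ 2) * P 2 ^ 2 := by
  constructor
  · intro hP
    have := hP (C γ * (X 0 - C x * X 2) ^ 2 - C (2 * β) * (X 0 - C x * X 2) * (X 1 - C y * X 2) +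
      C α * (X 1 - C y * X 2) ^ 2 - C (α * γ - β ^ 2) * X 2 ^ 2) (by
        intro ξ hξ
        rw [map_mul, eval_C, eval_conicPoly, mul_eq_zero] at hξ
        have hξ := hξ.resolve_left hk
        rw [gradient_C_mul, gradient_conicPoly]
        simp
        linear_combination (-4 * k ^ 2 * (α * γ - β ^ 2)) * hξ)
    simp at this
    linear_combination this
  · intro hP f hf
    set d := α * γ - β ^ 2 with hd
    set U := P 0 - x * P 2 with hU
    set V := P 1 - y * P 2 with hV
    have h2k : 2 * k ≠ 0 := mul_ne_zero two_ne_zero hk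
    set u := -(γ * U - β * V) / (2 * k * d) with hu
    set v := -(α * V - β * U) / (2 * k * d) with hv
    have := hf ![u, v, P 2 / (2 * k) - x * u - y * v] (by
      rw [map_mul, eval_C, eval_conicPoly]
      simp only [Matrix.cons_val_zero, Matrix.cons_val_one, Matrix.cons_val]
      rw [hu, hv]
      field_simp
      rw [hd] at hP ⊢
      linear_combination (-d) * hP)
    have e : gradient (C k * conicPoly x y α β γ) ![u, v, P 2 / (2 * k) - x * u - y * v] = P := by
      rw [gradient_C_mul, gradient_conicPoly]
      ext i
      fin_cases i
      · simp
        rw [hu, hv]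
        field_simp
        rw [hU, hd]
        ring
      · simp
        rw [hu, hv]
        field_simp
        rw [hV, hd]
        ring
      · simp
        field_simp
        ring
    rwa [e] at this

/-- The gradient of a linear form is constant, so all points of contact coincide. -/
theorem eq_of_mem_dualCurve_linear {g : MvPolynomial (Fin 3) ℂ} (hg : Irreducible g) {x y : ℂ}
    (h : g ∣ X 2 + C x * X 0 + C y * X 1) {P : Fin 3 → ℂ} (hP : P ∈ dualCurve g) :
    P 0 = x * P 2 ∧ P 1 = y * P 2 := by
  have hX : ∀ (c : ℂ) (i : Fin 3), (C c * X i : MvPolynomial (Fin 3) ℂ).IsHomogeneous 1 :=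
    fun c i => (isHomogeneous_X ℂ i).C_mul c
  obtain ⟨k, hk, hkg⟩ := exists_eq_C_mul_of_dvd (by
      intro h0
      have := congrArg (eval ![0, 0, 1]) h0
      simp at this)
    (((isHomogeneous_X ℂ 2).add (hX x 0)).add (hX y 1)).totalDegree_le hg h
  have h10 : pderiv (1 : Fin 3) (X 0 : MvPolynomial (Fin 3) ℂ) = 0 := pderiv_X_of_ne (by decide)
  have h12 : pderiv (1 : Fin 3) (X 2 : MvPolynomial (Fin 3) ℂ) = 0 := pderiv_X_of_ne (by decide)
  have h01 : pderiv (0 : Fin 3) (X 1 : MvPolynomial (Fin 3) ℂ) = 0 := pderiv_X_of_ne (by decide)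
  have h02 : pderiv (0 : Fin 3) (X 2 : MvPolynomial (Fin 3) ℂ) = 0 := pderiv_X_of_ne (by decide)
  have h20 : pderiv (2 : Fin 3) (X 0 : MvPolynomial (Fin 3) ℂ) = 0 := pderiv_X_of_ne (by decide)
  have h21 : pderiv (2 : Fin 3) (X 1 : MvPolynomial (Fin 3) ℂ) = 0 := pderiv_X_of_ne (by decide)
  have hgrad : ∀ ξ, k • gradient g ξ = ![x, y, 1] := by
    intro ξ
    rw [← gradient_C_mul, ← hkg]
    ext i
    fin_cases i <;> simp [gradient, h10, h12, h01, h02, h20, h21]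
  have g0 := fun ξ => congrFun (hgrad ξ) 0
  have g1 := fun ξ => congrFun (hgrad ξ) 1
  have g2 := fun ξ => congrFun (hgrad ξ) 2
  simp at g0 g1 g2
  constructor
  · have := hP (X 0 - C x * X 2) (by
      intro ξ _
      simp
      apply mul_left_cancel₀ hk
      linear_combination g0 ξ - x * g2 ξ)
    simpa [sub_eq_zero] using this
  · have := hP (X 1 - C y * X 2) (by
      intro ξ _
      simp
      apply mul_left_cancel₀ hk
      linear_combination g1 ξ - y * g2 ξ)
    simpa [sub_eq_zero] using this

/-! ### Factorization of the line polynomial and the boundary curve -/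

/-- The line polynomial of a block with the centre `c`. -/
def blockPoly (c Δ : ℂ) (M : ℝ) : MvPolynomial (Fin 3) ℂ :=
  conicPoly c.re c.im ((2 * Δ.re + M) / 4) (Δ.im / 2) ((-2 * Δ.re + M) / 4)

/-- In these coordinates `u Re^J(B) + v Im^J(B) = s B + t B^#`. The right side is `det (s B + t B^#
+ w)`: the trace gives the square, and the traceless part gives half the trace of its square. -/
theorem eval_blockPoly (c Δ : ℂ) (M : ℝ) (ξ : Fin 3 → ℂ) {s t : ℂ}
    (hs : s = (ξ 0 - Complex.I * ξ 1) / 2) (ht : t = (ξ 0 + Complex.I * ξ 1) / 2) :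
    eval ξ (blockPoly c Δ M) = (ξ 2 + s * c + t * conj c) ^ 2 -
      (s ^ 2 * Δ + t ^ 2 * conj Δ + s * t * M) := by
  have hu : ξ 0 = s + t := by rw [hs, ht]; ring
  have hv : ξ 1 = Complex.I * (s - t) := by
    rw [hs, ht]
    linear_combination (ξ 1) * Complex.I_sq
  have hc : conj c = c.re - c.im * Complex.I := by apply Complex.ext <;> simp
  have hΔ : conj Δ = Δ.re - Δ.im * Complex.I := by apply Complex.ext <;> simp
  rw [blockPoly, eval_conicPoly, hu, hv, hc, hΔ]
  have hc' := Complex.re_add_im c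
  have hΔ' := Complex.re_add_im Δ
  generalize c.re = c1 at *
  generalize c.im = c2 at *
  generalize Δ.re = d1 at *
  generalize Δ.im = d2 at *
  rw [← hc', ← hΔ']
  linear_combination (-((-2 * (d1 : ℂ) + M) / 4) * (s - t) ^ 2) * Complex.I_sq

theorem blockPoly_det (Δ : ℂ) (M : ℝ) :
    (((2 * Δ.re + M) / 4 : ℂ) * ((-2 * Δ.re + M) / 4) - (Δ.im / 2) ^ 2) =
      ((-conicDisc Δ M / 16 : ℝ) : ℂ) := by
  rw [conicDisc, Complex.sq_norm, Complex.normSq_apply]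
  push_cast
  ring

theorem eval_linePoly (a : ℝ) (b₁ b₂ b₃ : ℂ) (ξ : Fin 3 → ℂ) {s t : ℂ}
    (hs : s = (ξ 0 - Complex.I * ξ 1) / 2) (ht : t = (ξ 0 + Complex.I * ξ 1) / 2) :
    eval ξ (linePoly J4 (A4 a b₁ b₂ b₃)) =
      Matrix.det !![(s + t) * a + ξ 2, s * b₁ - t * conj b₃, 0, 0;
        s * b₃ - t * conj b₁, -((s + t) * a) + ξ 2, s * b₂ + t * conj b₂, 0;
        0, s * b₂ + t * conj b₂, -((s + t) * a) + ξ 2, s * b₃ - t * conj b₁;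
        0, 0, s * b₁ - t * conj b₃, (s + t) * a + ξ 2] := by
  have hu : ξ 0 = s + t := by rw [hs, ht]; ring
  have hv : ξ 1 = Complex.I * (s - t) := by
    rw [hs, ht]
    linear_combination (ξ 1) * Complex.I_sq
  rw [linePoly, RingHom.map_det]
  congr 1
  ext i j
  fin_cases i <;> fin_cases j <;>
    simp [rePart, imPart, adj, J4, A4, Matrix.mul_apply, Matrix.diagonal_apply, hu, hv] <;>
    first
    | ring1
    | (left; ring1)
    | (ring_nf; simp only [Complex.I_sq]; ring1)

theorem linePoly_eq (a : ℝ) (b₁ b₂ b₃ : ℂ) : linePoly J4 (A4 a b₁ b₂ b₃) =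
    blockPoly (b₂ / 2) (DeltaPlus a b₁ b₂ b₃) (MPlus a b₁ b₂ b₃) *
      blockPoly (-b₂ / 2) (DeltaPlus a b₁ (-b₂) b₃) (MPlus a b₁ (-b₂) b₃) := by
  apply MvPolynomial.funext
  intro ξ
  rw [map_mul, eval_linePoly a b₁ b₂ b₃ ξ rfl rfl, eval_blockPoly _ _ _ ξ rfl rfl,
    eval_blockPoly _ _ _ ξ rfl rfl]
  generalize (ξ 0 - Complex.I * ξ 1) / 2 = s
  generalize (ξ 0 + Complex.I * ξ 1) / 2 = t
  have hM : ∀ b : ℂ, (MPlus a b₁ b b₃ : ℂ) = 2 * (a : ℂ) ^ 2 - b₁ * conj b₁ - b₃ * conj b₃ +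
      b * conj b / 2 - a * (b + conj b) := by
    intro b
    rw [MPlus, M]
    push_cast
    rw [Complex.re_eq_add_conj]
    simp only [← Complex.mul_conj']
    ring
  rw [hM, hM]
  simp only [DeltaPlus, Delta, map_add, map_sub, map_mul, map_pow, map_div₀, map_neg,
    Complex.conj_ofReal, Complex.conj_ofNat]
  rw [Matrix.det_succ_row_zero]
  simp [Fin.sum_univ_four, Matrix.det_fin_three, Fin.succAbove]
  ring

/-- The real points of the envelope of the lines annihilated by `blockPoly`. -/
def blockCurve (c Δ : ℂ) (M : ℝ) : Set ℂ :=
  {z | ∃ g : MvPolynomial (Fin 3) ℂ, Irreducible g ∧ g ∣ blockPoly c Δ M ∧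
    (![(z.re : ℂ), (z.im : ℂ), 1] : Fin 3 → ℂ) ∈ dualCurve g}

theorem boundaryCurve_eq (a : ℝ) (b₁ b₂ b₃ : ℂ) : boundaryCurve J4 (A4 a b₁ b₂ b₃) =
    blockCurve (b₂ / 2) (DeltaPlus a b₁ b₂ b₃) (MPlus a b₁ b₂ b₃) ∪
      blockCurve (-b₂ / 2) (DeltaPlus a b₁ (-b₂) b₃) (MPlus a b₁ (-b₂) b₃) := by
  ext z
  constructor
  · rintro ⟨g, hg, hdvd, hz⟩
    rw [linePoly_eq] at hdvd
    exact (hg.prime.dvd_or_dvd hdvd).imp (fun h => ⟨g, hg, h, hz⟩) (fun h => ⟨g, hg, h, hz⟩)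
  · rintro (⟨g, hg, hdvd, hz⟩ | ⟨g, hg, hdvd, hz⟩)
    · exact ⟨g, hg, linePoly_eq a b₁ b₂ b₃ ▸ hdvd.mul_right _, hz⟩
    · exact ⟨g, hg, linePoly_eq a b₁ b₂ b₃ ▸ hdvd.mul_left _, hz⟩

theorem mem_blockCurve_iff {c Δ : ℂ} {M : ℝ} (h : conicDisc Δ M ≠ 0) (z : ℂ) :
    z ∈ blockCurve c Δ M ↔ conicForm Δ M (z - c) = conicDisc Δ M := by
  have hdet : ((2 * Δ.re + M) / 4 : ℂ) * ((-2 * Δ.re + M) / 4) - (Δ.im / 2) ^ 2 ≠ 0 := by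
    rw [blockPoly_det, Complex.ofReal_ne_zero]
    exact div_ne_zero (neg_ne_zero.2 h) (by norm_num)
  have hirr := irreducible_conicPoly (x := c.re) (y := c.im) hdet
  have key : ∀ k : ℂ, k ≠ 0 → ((![(z.re : ℂ), (z.im : ℂ), 1] : Fin 3 → ℂ) ∈
      dualCurve (C k * blockPoly c Δ M) ↔ conicForm Δ M (z - c) = conicDisc Δ M) := by
    intro k hk
    rw [blockPoly, mem_dualCurve_conicPoly hdet hk, blockPoly_det]
    simp only [Matrix.cons_val_zero, Matrix.cons_val_one, Matrix.cons_val, mul_one, one_pow]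
    have e : ((-2 * Δ.re + M) / 4 * (z.re - c.re) ^ 2 - 2 * (Δ.im / 2) * (z.re - c.re) *
        (z.im - c.im) + (2 * Δ.re + M) / 4 * (z.im - c.im) ^ 2 : ℂ) =
        ((-conicForm Δ M (z - c) / 16 : ℝ) : ℂ) := by
      rw [conicForm, Complex.normSq_apply]
      simp only [pow_two, Complex.mul_re, Complex.mul_im, Complex.conj_re, Complex.conj_im,
        Complex.sub_re, Complex.sub_im]
      push_cast
      ring
    rw [e, Complex.ofReal_inj]
    constructor <;> intro h <;> linarith
  constructor
  · rintro ⟨g, hg, hdvd, hz⟩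
    obtain ⟨u, hu⟩ := (hg.associated_of_dvd hirr hdvd).symm
    obtain ⟨k, hk, hk'⟩ := isUnit_iff_eq_C_of_isReduced.1 u.isUnit
    rw [hk', mul_comm] at hu
    rw [← hu] at hz
    exact (key k hk.ne_zero).1 hz
  · intro hz
    refine ⟨blockPoly c Δ M, hirr, dvd_rfl, ?_⟩
    have := (key 1 one_ne_zero).2 hz
    rwa [C_1, one_mul] at this

/-- If the inequality is strict, the conic is an ellipse or has no real points. In case of equality
the quadratic part is a square `(m u + n v)²`, so the form splits into two linear ones and at most
two points remain. -/
theorem blockCurve_bounded {c Δ : ℂ} {M : ℝ} (h : 2 * ‖Δ‖ ≤ |M|) :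
    ∃ R : ℝ, ∀ z ∈ blockCurve c Δ M, ‖z‖ ≤ R := by
  rcases h.lt_or_eq with h | h
  · have hD : conicDisc Δ M < 0 := by
      rw [conicDisc, ← sq_abs M]
      nlinarith [norm_nonneg Δ]
    refine ⟨‖c‖ + (1 + -conicDisc Δ M / (4 * |M| - 8 * ‖Δ‖)), fun z hz => ?_⟩
    have h1 := (mem_blockCurve_iff hD.ne z).1 hz
    set f := z - c with hf
    have h2 : |(conj Δ * f ^ 2).re| ≤ ‖Δ‖ * Complex.normSq f := by
      refine (Complex.abs_re_le_norm _).trans ?_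
      rw [norm_mul, norm_pow, Complex.sq_norm, Complex.norm_conj]
    have h3 : (4 * |M| - 8 * ‖Δ‖) * Complex.normSq f ≤ -conicDisc Δ M := by
      have hpos : 0 < 4 * |M| - 8 * ‖Δ‖ := by linarith
      rw [conicForm] at h1
      obtain ⟨h4, h5⟩ := abs_le.1 h2
      rcases abs_cases M with ⟨h6, -⟩ | ⟨h6, -⟩
      · rw [h6]; linarith
      · rw [h6] at hpos ⊢
        have := mul_nonneg hpos.le (Complex.normSq_nonneg f)
        nlinarith
    have h4 : ‖f‖ ^ 2 ≤ -conicDisc Δ M / (4 * |M| - 8 * ‖Δ‖) := by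
      rw [Complex.sq_norm, le_div_iff₀ (by linarith)]
      linarith
    have h5 : ‖f‖ ≤ 1 + ‖f‖ ^ 2 := by nlinarith [sq_nonneg (‖f‖ - 1), norm_nonneg f]
    have h6 : ‖z‖ ≤ ‖c‖ + ‖f‖ := by
      have := norm_add_le c f
      rwa [hf, add_sub_cancel] at this
    linarith
  · have hdet : ((2 * Δ.re + M) / 4 : ℂ) * ((-2 * Δ.re + M) / 4) - (Δ.im / 2) ^ 2 = 0 := by
      rw [blockPoly_det, Complex.ofReal_eq_zero, conicDisc, ← sq_abs M, ← h]
      ring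
    obtain ⟨m, n, e1, e2, e3⟩ : ∃ m n : ℂ, (2 * Δ.re + M) / 4 = m ^ 2 ∧ (Δ.im / 2 : ℂ) = m * n ∧
        (-2 * Δ.re + M) / 4 = n ^ 2 := by
      obtain ⟨m, hm⟩ := IsAlgClosed.exists_pow_nat_eq ((2 * Δ.re + M) / 4 : ℂ) two_pos
      rw [← hm] at hdet ⊢
      by_cases h0 : m = 0
      · subst h0
        obtain ⟨n, hn⟩ := IsAlgClosed.exists_pow_nat_eq ((-2 * Δ.re + M) / 4 : ℂ) two_pos
        refine ⟨0, n, rfl, ?_, hn.symm⟩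
        simpa using hdet
      · refine ⟨m, Δ.im / 2 / m, rfl, ?_, ?_⟩
        · rw [mul_div_cancel₀ _ h0]
        · rw [div_pow, eq_div_iff (pow_ne_zero 2 h0)]
          linear_combination hdet
    have hfac : blockPoly c Δ M =
        (X 2 + C ((c.re : ℂ) - m) * X 0 + C ((c.im : ℂ) - n) * X 1) *
        (X 2 + C ((c.re : ℂ) + m) * X 0 + C ((c.im : ℂ) + n) * X 1) := by
      rw [blockPoly, conicPoly, e1, e2, e3]
      simp only [map_add, map_sub, map_mul, map_pow]
      rw [show C (2 : ℂ) = (2 : MvPolynomial (Fin 3) ℂ) from map_ofNat C 2]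
      ring
    have bound : ∀ (z x y : ℂ), (z.re : ℂ) = x → (z.im : ℂ) = y → ‖z‖ ≤ ‖x‖ + ‖y‖ := by
      rintro z x y rfl rfl
      rw [Complex.norm_real, Complex.norm_real]
      exact Complex.norm_le_abs_re_add_abs_im z
    refine ⟨‖(c.re : ℂ) - m‖ + ‖(c.im : ℂ) - n‖ + (‖(c.re : ℂ) + m‖ + ‖(c.im : ℂ) + n‖), ?_⟩
    rintro z ⟨g, hg, hdvd, hz⟩
    rw [hfac] at hdvd
    rcases hg.prime.dvd_or_dvd hdvd with h1 | h1
    · obtain ⟨h2, h3⟩ := eq_of_mem_dualCurve_linear hg h1 hz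
      simp at h2 h3
      exact (bound z _ _ h2 h3).trans (le_add_of_nonneg_right (by positivity))
    · obtain ⟨h2, h3⟩ := eq_of_mem_dualCurve_linear hg h1 hz
      simp at h2 h3
      exact (bound z _ _ h2 h3).trans (le_add_of_nonneg_left (by positivity))

/-! ### Recovering the condition from the curve -/

/-- The standard parametrization of a hyperbola. -/
theorem Hyperbola.exists_param (H : Hyperbola) : ∃ (e : ℂ) (A B : ℝ), 0 < A ∧ 0 < B ∧ ‖e‖ = 1 ∧
    ∀ x y : ℝ, x ^ 2 - y ^ 2 = 1 →
      H.center + e * ((A * x : ℝ) + (B * y : ℝ) * Complex.I) ∈ H.curve := by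
  set δ := (H.focus₁ - H.focus₂) / 2 with hδ
  have h1 := H.param_lt
  have h2 := H.neg_lt_param
  rw [← hδ] at h1 h2
  have hρ : 0 < ‖δ‖ := by
    by_contra! h0
    have : ‖δ‖ = 0 := le_antisymm h0 (norm_nonneg _)
    rw [this] at h1 h2
    linarith
  have hρ' : (‖δ‖ : ℂ) ≠ 0 := by exact_mod_cast hρ.ne'
  refine ⟨δ / ‖δ‖, √((2 * ‖δ‖ ^ 2 + H.param) / 4), √((2 * ‖δ‖ ^ 2 - H.param) / 4),
    Real.sqrt_pos.2 (by linarith), Real.sqrt_pos.2 (by linarith), ?_, ?_⟩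
  · rw [norm_div, Complex.norm_real, norm_norm, div_self hρ.ne']
  · intro x y hxy
    have hA := Real.sq_sqrt (show 0 ≤ (2 * ‖δ‖ ^ 2 + H.param) / 4 by linarith)
    have hB := Real.sq_sqrt (show 0 ≤ (2 * ‖δ‖ ^ 2 - H.param) / 4 by linarith)
    set A := √((2 * ‖δ‖ ^ 2 + H.param) / 4)
    set B := √((2 * ‖δ‖ ^ 2 - H.param) / 4)
    rw [mem_curve_iff, ← hδ, add_sub_cancel_left]
    set g : ℂ := (A * x : ℝ) + (B * y : ℝ) * Complex.I with hg
    have e1 : conj (δ ^ 2) * (δ / ‖δ‖ * g) ^ 2 = ((‖δ‖ ^ 2 : ℝ) : ℂ) * g ^ 2 := by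
      have : conj (δ ^ 2) * (δ / ‖δ‖ * g) ^ 2 = (δ * conj δ) ^ 2 / ‖δ‖ ^ 2 * g ^ 2 := by
        rw [map_pow]; field_simp
      rw [this, Complex.mul_conj']
      push_cast
      field_simp
    have e2 : Complex.normSq (δ / ‖δ‖ * g) = Complex.normSq g := by
      rw [Complex.normSq_mul, Complex.normSq_div, Complex.normSq_ofReal, ← Complex.sq_norm,
        ← pow_two, div_self (pow_ne_zero 2 hρ.ne'), one_mul]
    have gr : g.re = A * x := by simp [hg]
    have gi : g.im = B * y := by simp [hg]
    rw [conicForm, e1, e2, Complex.re_ofReal_mul, conicDisc, norm_pow, Complex.normSq_apply,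
      pow_two g, Complex.mul_re, gr, gi]
    have hA' : ‖δ‖ ^ 2 = A ^ 2 + B ^ 2 := by linarith
    have hB' : H.param = 2 * A ^ 2 - 2 * B ^ 2 := by linarith
    rw [hA', hB']
    linear_combination (16 * A ^ 2 * B ^ 2) * hxy

/-- If a hyperbola lies on a central hyperbola outside a disc, then the centres agree. -/
theorem Hyperbola.center_eq (H : Hyperbola) {c Δ : ℂ} {M R : ℝ} (hM : |M| < 2 * ‖Δ‖)
    (h : ∀ z ∈ H.curve, R < ‖z‖ → conicForm Δ M (z - c) = conicDisc Δ M) : H.center = c := by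
  obtain ⟨e, A, B, hA, hB, he, hcurve⟩ := H.exists_param
  -- Large enough that the four points with parameters `(±x, ±y)` lie outside the disc.
  set y := (|R| + ‖H.center‖ + 1) / A with hy
  have hy0 : 0 < y := by positivity
  set x := √(1 + y ^ 2) with hx
  have hx2 : x ^ 2 = 1 + y ^ 2 := Real.sq_sqrt (by positivity)
  have hx0 : 0 < x := Real.sqrt_pos.2 (by positivity)
  have hxy : y < x := Real.lt_sqrt_of_sq_lt (by linarith)
  have hAy : A * y = |R| + ‖H.center‖ + 1 := by rw [hy, mul_div_cancel₀ _ hA.ne']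
  set d := H.center - c with hd
  have key : ∀ x' y' : ℝ, |x'| = x → x' ^ 2 - y' ^ 2 = 1 →
      conicForm Δ M (d + e * ((A * x' : ℝ) + (B * y' : ℝ) * Complex.I)) = conicDisc Δ M := by
    intro x' y' h1 h2
    have h3 := h _ (hcurve x' y' h2) (by
      set g : ℂ := (A * x' : ℝ) + (B * y' : ℝ) * Complex.I with hg
      have h4 : A * x ≤ ‖e * g‖ := by
        rw [norm_mul, he, one_mul]
        refine le_trans (le_of_eq ?_) (Complex.abs_re_le_norm g)
        rw [hg, ← h1]
        simp [abs_mul, abs_of_pos hA]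
      have h5 := norm_sub_le (H.center + e * g) H.center
      rw [add_sub_cancel_left] at h5
      have h6 : A * y < A * x := mul_lt_mul_of_pos_left hxy hA
      linarith [le_abs_self R])
    rw [← h3, hd]
    congr 1
    ring
  -- The difference at points opposite with respect to `H.center` is linear in `d`. Two independent
  -- pairs show that the polar form of `conicForm` annihilates `d`, which nondegeneracy allows only
  -- for `d = 0`.
  have expand : ∀ X Y : ℝ, conicForm Δ M (d + e * ((X : ℝ) + (Y : ℝ) * Complex.I)) -
      conicForm Δ M (d + e * ((-X : ℝ) + (-Y : ℝ) * Complex.I)) =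
      4 * (X * ((8 * conj Δ * d - 4 * M * conj d) * e).re -
        Y * ((8 * conj Δ * d - 4 * M * conj d) * e).im) := by
    intro X Y
    simp [conicForm, Complex.normSq_apply, pow_two]
    ring
  have k1 := key x y (abs_of_pos hx0) (by linarith)
  have k2 := key (-x) (-y) (by rw [abs_neg, abs_of_pos hx0]) (by rw [neg_sq, neg_sq]; linarith)
  have k3 := key x (-y) (abs_of_pos hx0) (by rw [neg_sq]; linarith)
  have k4 := key (-x) y (by rw [abs_neg, abs_of_pos hx0]) (by rw [neg_sq]; linarith)
  have x1 := expand (A * x) (B * y)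
  have x2 := expand (A * x) (B * -y)
  rw [← mul_neg, ← mul_neg, k1, k2] at x1
  rw [← mul_neg, ← mul_neg, neg_neg, k3, k4] at x2
  set w := (8 * conj Δ * d - 4 * M * conj d) * e with hw
  have hAx : A * x ≠ 0 := by positivity
  have hBy : B * y ≠ 0 := by positivity
  have hre : w.re = 0 := by
    apply mul_left_cancel₀ hAx
    linarith
  have him : w.im = 0 := by
    apply mul_left_cancel₀ hBy
    linarith
  have hw0 : w = 0 := Complex.ext hre him
  have he0 : e ≠ 0 := by
    rintro rfl
    simp at he
  have hv := (mul_eq_zero.1 (hw ▸ hw0)).resolve_right he0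
  have hv' := congrArg norm (sub_eq_zero.1 hv)
  simp only [norm_mul, Complex.norm_conj, Complex.norm_real, Real.norm_eq_abs,
    Complex.norm_ofNat] at hv'
  by_contra hne
  have hd0 : 0 < ‖d‖ := norm_pos_iff.2 (sub_ne_zero.2 hne)
  nlinarith

theorem bihyperbolic_iff (a : ℝ) (b₁ b₂ b₃ : ℂ) : Bihyperbolic a b₁ b₂ b₃ ↔ b₂ ≠ 0 ∧
    |MPlus a b₁ b₂ b₃| < 2 * ‖DeltaPlus a b₁ b₂ b₃‖ ∧
    |MPlus a b₁ (-b₂) b₃| < 2 * ‖DeltaPlus a b₁ (-b₂) b₃‖ := by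
  rw [Bihyperbolic, DeltaMinus_eq, MMinus_eq]

/-- If the condition fails, the part of the curve outside some disc lies on a single central
hyperbola, and `Hyperbola.center_eq` makes `H` and `H'` concentric. -/
theorem bihyperbolic_of_boundaryCurve_eq {a : ℝ} {b₁ b₂ b₃ : ℂ} {H H' : Hyperbola}
    (hne : H.center ≠ H'.center)
    (h : boundaryCurve J4 (A4 a b₁ b₂ b₃) = H.curve ∪ H'.curve) : Bihyperbolic a b₁ b₂ b₃ := by
  have concentric : ∀ {c Δ : ℂ} {M R : ℝ}, |M| < 2 * ‖Δ‖ →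
      (∀ z ∈ boundaryCurve J4 (A4 a b₁ b₂ b₃), R < ‖z‖ →
        conicForm Δ M (z - c) = conicDisc Δ M) → False := by
    intro c Δ M R hM hz
    rw [h] at hz
    exact hne ((H.center_eq hM fun z hzH => hz z (Or.inl hzH)).trans
      (H'.center_eq hM fun z hzH => hz z (Or.inr hzH)).symm)
  have hyp : ∀ {c Δ : ℂ} {M : ℝ}, |M| < 2 * ‖Δ‖ → ∀ z ∈ blockCurve c Δ M,
      conicForm Δ M (z - c) = conicDisc Δ M :=
    fun hM z hz => (mem_blockCurve_iff (conicDisc_pos hM).ne' z).1 hz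
  rw [boundaryCurve_eq] at concentric
  rw [bihyperbolic_iff]
  by_contra hcon
  by_cases h1 : |MPlus a b₁ b₂ b₃| < 2 * ‖DeltaPlus a b₁ b₂ b₃‖
  · by_cases h2 : |MPlus a b₁ (-b₂) b₃| < 2 * ‖DeltaPlus a b₁ (-b₂) b₃‖
    · have hb : b₂ = 0 := by
        by_contra hb
        exact hcon ⟨hb, h1, h2⟩
      subst hb
      rw [neg_zero, Set.union_self] at concentric
      exact concentric (c := 0 / 2) (R := 0) h1 fun z hz _ => hyp h1 z hz
    · obtain ⟨R, hR⟩ := blockCurve_bounded (c := -b₂ / 2) (not_lt.1 h2)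
      refine concentric (c := b₂ / 2) (R := R) h1 fun z hz hRz => ?_
      rcases hz with hz | hz
      · exact hyp h1 z hz
      · exact absurd (hR z hz) hRz.not_ge
  · obtain ⟨R, hR⟩ := blockCurve_bounded (c := b₂ / 2) (not_lt.1 h1)
    by_cases h2 : |MPlus a b₁ (-b₂) b₃| < 2 * ‖DeltaPlus a b₁ (-b₂) b₃‖
    · refine concentric (c := -b₂ / 2) (R := R) h2 fun z hz hRz => ?_
      rcases hz with hz | hz
      · exact absurd (hR z hz) hRz.not_ge
      · exact hyp h2 z hz
    · obtain ⟨R', hR'⟩ := blockCurve_bounded (c := -b₂ / 2) (not_lt.1 h2)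
      -- Outside the larger disc the curve is empty, so any central hyperbola serves.
      refine concentric (c := 0) (Δ := 1) (M := 0) (R := max R R') (by simp) fun z hz hRz => ?_
      rcases hz with hz | hz
      · exact absurd (hR z hz) (lt_of_le_of_lt (le_max_left _ _) hRz).not_ge
      · exact absurd (hR' z hz) (lt_of_le_of_lt (le_max_right _ _) hRz).not_ge

theorem bihyperbolic_hyperbolas {a : ℝ} {b₁ b₂ b₃ : ℂ} (h : Bihyperbolic a b₁ b₂ b₃) {δp δm : ℂ}
    (hp : δp ^ 2 = DeltaPlus a b₁ b₂ b₃) (hm : δm ^ 2 = DeltaMinus a b₁ b₂ b₃) :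
    ∃ Hp Hm : Hyperbola,
      Hp.focus₁ = b₂ / 2 + δp ∧ Hp.focus₂ = b₂ / 2 - δp ∧
      Hp.nonTransverse = √(2 * ‖DeltaPlus a b₁ b₂ b₃‖ - MPlus a b₁ b₂ b₃) ∧
      Hm.focus₁ = -b₂ / 2 + δm ∧ Hm.focus₂ = -b₂ / 2 - δm ∧
      Hm.nonTransverse = √(2 * ‖DeltaMinus a b₁ b₂ b₃‖ - MMinus a b₁ b₂ b₃) ∧
      boundaryCurve J4 (A4 a b₁ b₂ b₃) = Hp.curve ∪ Hm.curve ∧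
      numRange J4 (A4 a b₁ b₂ b₃) =
        pseudoConvexHull J4 (A4 a b₁ b₂ b₃) (Hp.curve ∪ Hm.curve) := by
  obtain ⟨-, h1, h2⟩ := (bihyperbolic_iff a b₁ b₂ b₃).1 h
  rw [DeltaMinus_eq] at hm
  rw [DeltaMinus_eq, MMinus_eq]
  have h1' : |MPlus a b₁ b₂ b₃| < 2 * ‖δp ^ 2‖ := by rwa [hp]
  have h2' : |MPlus a b₁ (-b₂) b₃| < 2 * ‖δm ^ 2‖ := by rwa [hm]
  have cp := fun z => Hyperbola.mem_ofCenter_curve (c := b₂ / 2) h1' z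
  have cm := fun z => Hyperbola.mem_ofCenter_curve (c := -b₂ / 2) h2' z
  rw [hp] at cp
  rw [hm] at cm
  refine ⟨Hyperbola.ofCenter (b₂ / 2) δp _ h1', Hyperbola.ofCenter (-b₂ / 2) δm _ h2', rfl, rfl,
    by rw [Hyperbola.ofCenter_nonTransverse, hp], rfl, rfl,
    by rw [Hyperbola.ofCenter_nonTransverse, hm], ?_, ?_⟩
  · rw [boundaryCurve_eq]
    congr 1
    · ext z
      rw [mem_blockCurve_iff (conicDisc_pos h1).ne', cp]
    · ext z
      rw [mem_blockCurve_iff (conicDisc_pos h2).ne', cm]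
  · exact Set.Subset.antisymm
      (numRange_subset_hull h1 h2 (fun z hz => Or.inl ((cp z).2 hz))
        (fun z hz => Or.inr ((cm z).2 hz)))
      (pseudoConvexHull_subset J4_isHermitian _)

theorem exists_disc {a : ℝ} {b₁ b₃ δ : ℂ} (h : |M a b₁ b₃| < 2 * ‖Delta a b₁ b₃‖)
    (hδ : δ ^ 2 = Delta a b₁ b₃) :
    ∃ H : Hyperbola, H.focus₁ = δ ∧ H.focus₂ = -δ ∧
      H.nonTransverse = √(2 * ‖Delta a b₁ b₃‖ - M a b₁ b₃) ∧
      numRange J4 (A4 a b₁ 0 b₃) = H.disc := by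
  have e1 : DeltaPlus a b₁ 0 b₃ = Delta a b₁ b₃ := by simp [DeltaPlus]
  have e2 : MPlus a b₁ 0 b₃ = M a b₁ b₃ := by simp [MPlus]
  have h' : |M a b₁ b₃| < 2 * ‖δ ^ 2‖ := by rwa [hδ]
  refine ⟨Hyperbola.ofCenter 0 δ _ h', by simp, by simp,
    by rw [Hyperbola.ofCenter_nonTransverse, hδ], ?_⟩
  ext z
  rw [Hyperbola.mem_ofCenter_disc h', sub_zero, hδ, numRange_eq_of_zero (by rwa [e1, e2]), e1, e2]

end

end Krein

theorem theorem3p3 :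
    (∀ (a : ℝ) (b₁ b₂ b₃ : ℂ),
      -- (a), the equivalence
      ((∃ H H' : Krein.Hyperbola, H.center ≠ H'.center ∧
          Krein.boundaryCurve Krein.J4 (Krein.A4 a b₁ b₂ b₃) = H.curve ∪ H'.curve) ↔
        Krein.Bihyperbolic a b₁ b₂ b₃) ∧
      -- (a), the hyperbolas and the numerical range in this case
      (Krein.Bihyperbolic a b₁ b₂ b₃ →
        ∀ δp δm : ℂ, δp ^ 2 = Krein.DeltaPlus a b₁ b₂ b₃ →
          δm ^ 2 = Krein.DeltaMinus a b₁ b₂ b₃ →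
        ∃ Hp Hm : Krein.Hyperbola,
          Hp.focus₁ = b₂ / 2 + δp ∧ Hp.focus₂ = b₂ / 2 - δp ∧
          Hp.nonTransverse =
            √(2 * ‖Krein.DeltaPlus a b₁ b₂ b₃‖ - Krein.MPlus a b₁ b₂ b₃) ∧
          Hm.focus₁ = -b₂ / 2 + δm ∧ Hm.focus₂ = -b₂ / 2 - δm ∧
          Hm.nonTransverse =
            √(2 * ‖Krein.DeltaMinus a b₁ b₂ b₃‖ - Krein.MMinus a b₁ b₂ b₃) ∧
          Krein.boundaryCurve Krein.J4 (Krein.A4 a b₁ b₂ b₃) = Hp.curve ∪ Hm.curve ∧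
          Krein.numRange Krein.J4 (Krein.A4 a b₁ b₂ b₃) =
            Krein.pseudoConvexHull Krein.J4 (Krein.A4 a b₁ b₂ b₃) (Hp.curve ∪ Hm.curve)) ∧
      -- (b)
      (b₂ = 0 → |Krein.M a b₁ b₃| < 2 * ‖Krein.Delta a b₁ b₃‖ →
        ∀ δ : ℂ, δ ^ 2 = Krein.Delta a b₁ b₃ →
        ∃ H : Krein.Hyperbola,
          H.focus₁ = δ ∧ H.focus₂ = -δ ∧
          H.nonTransverse = √(2 * ‖Krein.Delta a b₁ b₃‖ - Krein.M a b₁ b₃) ∧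
          Krein.numRange Krein.J4 (Krein.A4 a b₁ b₂ b₃) = H.disc)) ∧
    -- (a), flat portions on the boundary may exist
    (∃ (a : ℝ) (b₁ b₂ b₃ : ℂ), Krein.Bihyperbolic a b₁ b₂ b₃ ∧
      ∃ p q : ℂ, p ≠ q ∧
        segment ℝ p q ⊆ frontier (Krein.numRange Krein.J4 (Krein.A4 a b₁ b₂ b₃))) ∧
    -- (a), the numerical range may be the whole complex plane
    (∃ (a : ℝ) (b₁ b₂ b₃ : ℂ), Krein.Bihyperbolic a b₁ b₂ b₃ ∧
      Krein.numRange Krein.J4 (Krein.A4 a b₁ b₂ b₃) = Set.univ) := by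
  refine ⟨fun a b₁ b₂ b₃ => ⟨⟨?_, fun h => ?_⟩, fun h δp δm hp hm =>
    Krein.bihyperbolic_hyperbolas h hp hm, ?_⟩, Krein.exists_flat_portion,
    Krein.exists_numRange_eq_univ⟩
  · rintro ⟨H, H', hne, h⟩
    exact Krein.bihyperbolic_of_boundaryCurve_eq hne h
  · obtain ⟨δp, hp⟩ := IsAlgClosed.exists_pow_nat_eq (Krein.DeltaPlus a b₁ b₂ b₃) two_pos
    obtain ⟨δm, hm⟩ := IsAlgClosed.exists_pow_nat_eq (Krein.DeltaMinus a b₁ b₂ b₃) two_pos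
    obtain ⟨Hp, Hm, h1, h2, -, h3, h4, -, h5, -⟩ := Krein.bihyperbolic_hyperbolas h hp hm
    -- The centres are `b₂ / 2` and `-b₂ / 2`, equal only for `b₂ = 0`.
    refine ⟨Hp, Hm, fun hc => h.1 ?_, h5⟩
    rw [Krein.Hyperbola.center, Krein.Hyperbola.center, h1, h2, h3, h4] at hc
    linear_combination hc
  · rintro rfl h δ hδ
    exact Krein.exists_disc h hδ
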